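/- Let $\mathbf{PL}$ be the category of piecewise linear (PL) spaces (second countable Hausdorff spaces with a maximal atlas of pairwise compatible PL charts $|K|\to X$, $K$ a finite simplicial complex) and PL maps. A \emph{quasi-PL space} is a functor $\mathcal F:\mathbf{PL}^{op}\to\mathbf{Sets}$ which is a sheaf for open covers and such that, for every PL space $P$ and every locally finite cover $\{Q_i\}_i$ of $P$ by closed PL subspaces, the diagram $\mathcal F(P)\to\prod_i\mathcal F(Q_i)\rightrightarrows\prod_{i,j}\mathcal F(Q_i\cap Q_j)$ of restriction maps is an equalizer. The \emph{underlying simplicial set} $\mathcal F_\bullet$ of a functor $\mathcal F:\mathbf{PL}^{op}\to\mathbf{Sets}$ is the composite of $\mathcal F$ with $[p]\mapsto\Delta^p$, where $\Delta^p\subset\mathbb R^{p+1}$ is the standard geometric simplex and morphisms of $\Delta$ act by the induced linear maps. Proposition. Let $\mathcal F:\mathbf{PL}^{op}\to\mathbf{Sets}$ be a quasi-PL space and let $\mathcal F'\subseteq\mathcal F$ be a subfunctor (i.e. subsets $\mathcal F'(P)\subseteq\mathcal F(P)$ for all PL spaces $P$, preserved by $f^*$ for all PL maps $f$; $\mathcal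 F'$ need not be a quasi-PL space itself). Suppose that for every PL space $P$ and every $W\in\mathcal F(P)$ there is an open cover $\mathcal U$ of $P$ such that for each $U\in\mathcal U$ the restriction $W_U$ belongs to $\mathcal F'(U)$. Then the inclusion of simplicial sets $\mathcal F'_\bullet\hookrightarrow\mathcal F_\bullet$ is a weak homotopy equivalence, i.e. its geometric realization induces bijections on path components and on all homotopy groups at all base points. -/

import Mathlib

open CategoryTheory Opposite Topology Set

universe u

/-! ### Compact polyhedra and PL charts -/

/-- A (possibly empty) convex polytope in `ℝⁿ`: a bounded intersection of finitely many closed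
half-spaces. -/
def IsPolytope {n : ℕ} (C : Set (Fin n → ℝ)) : Prop :=
  Bornology.IsBounded C ∧
    ∃ H : Set (((Fin n → ℝ) →ₗ[ℝ] ℝ) × ℝ), H.Finite ∧ C = {x | ∀ h ∈ H, h.1 x ≤ h.2}

/-- A compact polyhedron in `ℝⁿ`: a finite union of convex polytopes. These are exactly the
underlying spaces `|K|` of the finite simplicial complexes `K` of linear simplices in `ℝⁿ`. -/
def IsPolyhedron {n : ℕ} (C : Set (Fin n → ℝ)) : Prop :=
  ∃ T : Set (Set (Fin n → ℝ)), T.Finite ∧ (∀ P ∈ T, IsPolytope P) ∧ ⋃₀ T = C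

/-- A PL chart for `X`: a topological embedding `|K| → X` of a compact polyhedron. -/
structure PLChart (X : Type) [TopologicalSpace X] where
  dim : ℕ
  dom : Set (Fin dim → ℝ)
  isPolyhedron : IsPolyhedron dom
  toFun : dom → X
  isEmbedding : IsEmbedding toFun

/-- The image of a PL chart. -/
def PLChart.image {X : Type} [TopologicalSpace X] (c : PLChart X) : Set X := range c.toFun

/-- In the charts `c` and `d`, the map `f` is defined and piecewise affine on the set `S`: `S` is a
finite union of polytopes contained in the domain of `c`, each of which `d⁻¹ ∘ f ∘ c` is defined on
and agrees with an affine map on. -/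
def PLOn {X Y : Type} [TopologicalSpace X] [TopologicalSpace Y] (f : X → Y)
    (c : PLChart X) (d : PLChart Y) (S : Set (Fin c.dim → ℝ)) : Prop :=
  ∃ T : Set (Set (Fin c.dim → ℝ)), T.Finite ∧ ⋃₀ T = S ∧
    ∀ P ∈ T, IsPolytope P ∧ ∃ A : (Fin c.dim → ℝ) →ᵃ[ℝ] (Fin d.dim → ℝ),
      ∀ x ∈ P, ∃ (hx : x ∈ c.dom) (hy : A x ∈ d.dom), d.toFun ⟨A x, hy⟩ = f (c.toFun ⟨x, hx⟩)

/-- The set `c⁻¹(f⁻¹(d(|L|)))`, as a subset of the Euclidean space containing the domain of `c`. -/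
def chartPreimage {X Y : Type} [TopologicalSpace X] [TopologicalSpace Y] (f : X → Y)
    (c : PLChart X) (d : PLChart Y) : Set (Fin c.dim → ℝ) :=
  {x | ∃ hx : x ∈ c.dom, f (c.toFun ⟨x, hx⟩) ∈ d.image}

/-- `f` is piecewise linear with respect to the charts `c` and `d`: the composite `d⁻¹ ∘ f ∘ c` is
piecewise linear on its whole domain of definition, which is a compact polyhedron. -/
def PLInCharts {X Y : Type} [TopologicalSpace X] [TopologicalSpace Y] (f : X → Y)
    (c : PLChart X) (d : PLChart Y) : Prop :=
  PLOn f c d (chartPreimage f c d)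

/-- Two charts are compatible if both transition maps `d⁻¹ ∘ c` and `c⁻¹ ∘ d` are piecewise linear
maps between the compact polyhedra `c⁻¹(c(|K|) ∩ d(|L|))` and `d⁻¹(c(|K|) ∩ d(|L|))`. -/
def PLChart.Compatible {X : Type} [TopologicalSpace X] (c d : PLChart X) : Prop :=
  PLInCharts id c d ∧ PLInCharts id d c

/-- A PL structure: a maximal collection of pairwise compatible charts whose images contain
a neighbourhood of every point. -/
structure PLStructure (X : Type) [TopologicalSpace X] where
  charts : Set (PLChart X)
  compatible : ∀ c ∈ charts, ∀ d ∈ charts, c.Compatible d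
  cover : ∀ x : X, ∃ c ∈ charts, c.image ∈ 𝓝 x
  maximal : ∀ c : PLChart X, (∀ d ∈ charts, c.Compatible d) → c ∈ charts

/-- A PL space: a second countable Hausdorff space with a PL structure. -/
structure PLSpace where
  carrier : Type
  [top : TopologicalSpace carrier]
  [t2 : T2Space carrier]
  [secondCountable : SecondCountableTopology carrier]
  str : PLStructure carrier

instance : CoeSort PLSpace Type := ⟨PLSpace.carrier⟩

attribute [instance] PLSpace.top PLSpace.t2 PLSpace.secondCountable

/-- A PL map: a continuous map which is piecewise linear in suitable charts around `x` and `f x`,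
for every point `x`. -/
def IsPLMap {P Q : PLSpace} (f : P → Q) : Prop :=
  Continuous f ∧ ∀ x : P, ∃ c ∈ P.str.charts, ∃ d ∈ Q.str.charts,
    c.image ∈ 𝓝 x ∧ d.image ∈ 𝓝 (f x) ∧ MapsTo f c.image d.image ∧ PLInCharts f c d

/-! ### Elementary facts needed for the category of PL spaces -/

theorem IsPolytope.inter {n : ℕ} {C D : Set (Fin n → ℝ)} (hC : IsPolytope C) (hD : IsPolytope D) :
    IsPolytope (C ∩ D) := by
  obtain ⟨bC, H, hH, rfl⟩ := hC
  obtain ⟨bD, H', hH', rfl⟩ := hD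
  refine ⟨bC.subset inter_subset_left, H ∪ H', hH.union hH', ?_⟩
  ext x
  constructor
  · rintro ⟨h1, h2⟩ h (hh | hh)
    exacts [h1 h hh, h2 h hh]
  · intro h
    exact ⟨fun k hk => h k (Or.inl hk), fun k hk => h k (Or.inr hk)⟩

theorem IsPolytope.inter_preimage {n m : ℕ} {C : Set (Fin n → ℝ)} {D : Set (Fin m → ℝ)}
    (hC : IsPolytope C) (hD : IsPolytope D) (A : (Fin n → ℝ) →ᵃ[ℝ] (Fin m → ℝ)) :
    IsPolytope (C ∩ A ⁻¹' D) := by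
  obtain ⟨bC, H, hH, rfl⟩ := hC
  obtain ⟨bD, H', hH', rfl⟩ := hD
  refine ⟨bC.subset inter_subset_left,
    H ∪ (fun h => (h.1 ∘ₗ A.linear, h.2 - h.1 (A 0))) '' H', hH.union (hH'.image _), ?_⟩
  have key : ∀ (h : ((Fin m → ℝ) →ₗ[ℝ] ℝ) × ℝ) (x : Fin n → ℝ),
      (h.1 ∘ₗ A.linear) x ≤ h.2 - h.1 (A 0) ↔ h.1 (A x) ≤ h.2 := by
    intro h x
    have : A x = A.linear x + A 0 := by
      have := A.map_vadd 0 x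
      simpa using this
    rw [this, map_add, LinearMap.comp_apply]
    constructor <;> intro h <;> linarith
  ext x
  constructor
  · rintro ⟨h1, h2⟩ h (hh | ⟨k, hk, rfl⟩)
    · exact h1 h hh
    · exact (key k x).2 (h2 k hk)
  · intro h
    exact ⟨fun k hk => h k (Or.inl hk), fun k hk => (key k x).1 (h _ (Or.inr ⟨k, hk, rfl⟩))⟩

theorem IsPolytope.isCompact {n : ℕ} {C : Set (Fin n → ℝ)} (hC : IsPolytope C) : IsCompact C := by
  obtain ⟨bC, H, hH, rfl⟩ := hC
  refine Metric.isCompact_of_isClosed_isBounded ?_ bC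
  have : {x : Fin n → ℝ | ∀ h ∈ H, h.1 x ≤ h.2} = ⋂ h ∈ H, {x | h.1 x ≤ h.2} := by
    ext x; simp
  rw [this]
  refine isClosed_biInter fun h _ => isClosed_le ?_ continuous_const
  exact LinearMap.continuous_of_finiteDimensional h.1

theorem IsPolyhedron.isCompact {n : ℕ} {C : Set (Fin n → ℝ)} (hC : IsPolyhedron C) :
    IsCompact C := by
  obtain ⟨T, hT, hP, rfl⟩ := hC
  exact hT.isCompact_sUnion fun P h => (hP P h).isCompact

theorem isPolytope_Icc {n : ℕ} (a b : Fin n → ℝ) : IsPolytope (Icc a b) := by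
  refine ⟨Metric.isBounded_Icc a b, range (fun i => (LinearMap.proj i, b i)) ∪
    range (fun i => (-LinearMap.proj i, -a i)), (finite_range _).union (finite_range _), ?_⟩
  ext x
  constructor
  · rintro ⟨h1, h2⟩ h (⟨i, rfl⟩ | ⟨i, rfl⟩)
    · exact h2 i
    · simpa using h1 i
  · intro h
    refine ⟨fun i => ?_, fun i => h _ (Or.inl ⟨i, rfl⟩)⟩
    have := h _ (Or.inr ⟨i, rfl⟩)
    simpa using this

theorem isPolytope_stdSimplex (n : ℕ) : IsPolytope (stdSimplex ℝ (Fin n)) := by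
  refine ⟨(isCompact_stdSimplex ℝ (Fin n)).isBounded,
    range (fun i => (-LinearMap.proj i, 0)) ∪
      {(∑ i, LinearMap.proj i, 1), (-∑ i, LinearMap.proj i, -1)},
    (finite_range _).union (by simp), ?_⟩
  ext x
  constructor
  · rintro ⟨h1, h2⟩ h (⟨i, rfl⟩ | rfl | rfl)
    · simpa using h1 i
    · simp [h2]
    · simp [h2]
  · intro h
    refine ⟨fun i => ?_, le_antisymm ?_ ?_⟩
    · have := h _ (Or.inl ⟨i, rfl⟩)
      simpa using this
    · have := h _ (Or.inr (Or.inl rfl))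
      simpa using this
    · have := h _ (Or.inr (Or.inr rfl))
      simpa using this

theorem IsPolyhedron.inter {n : ℕ} {C D : Set (Fin n → ℝ)} (hC : IsPolyhedron C)
    (hD : IsPolyhedron D) : IsPolyhedron (C ∩ D) := by
  obtain ⟨T, hT, hP, rfl⟩ := hC
  obtain ⟨T', hT', hP', rfl⟩ := hD
  refine ⟨image2 (· ∩ ·) T T', hT.image2 _ hT', ?_, ?_⟩
  · rintro _ ⟨P, h, P', h', rfl⟩
    exact (hP P h).inter (hP' P' h')
  · ext x
    constructor
    · rintro ⟨_, ⟨P, h, P', h', rfl⟩, hx, hx'⟩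
      exact ⟨⟨P, h, hx⟩, ⟨P', h', hx'⟩⟩
    · rintro ⟨⟨P, h, hx⟩, ⟨P', h', hx'⟩⟩
      exact ⟨_, ⟨P, h, P', h', rfl⟩, hx, hx'⟩

theorem IsPolytope.isPolyhedron {n : ℕ} {C : Set (Fin n → ℝ)} (hC : IsPolytope C) :
    IsPolyhedron C := ⟨{C}, by simp, by simpa using hC, by simp⟩

section PLOn

variable {X Y Z : Type} [TopologicalSpace X] [TopologicalSpace Y] [TopologicalSpace Z]

theorem PLOn.isPolyhedron {f : X → Y} {c : PLChart X} {d : PLChart Y} {S : Set (Fin c.dim → ℝ)}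
    (h : PLOn f c d S) : IsPolyhedron S := by
  obtain ⟨T, hT, hS, h⟩ := h
  exact ⟨T, hT, fun P hP => (h P hP).1, hS⟩

theorem PLOn.empty (f : X → Y) (c : PLChart X) (d : PLChart Y) : PLOn f c d ∅ :=
  ⟨∅, by simp, by simp, by simp⟩

theorem PLOn.union {f : X → Y} {c : PLChart X} {d : PLChart Y} {S S' : Set (Fin c.dim → ℝ)}
    (h : PLOn f c d S) (h' : PLOn f c d S') : PLOn f c d (S ∪ S') := by
  obtain ⟨T, hT, rfl, h⟩ := h
  obtain ⟨T', hT', rfl, h'⟩ := h'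
  refine ⟨T ∪ T', hT.union hT', sUnion_union _ _, ?_⟩
  rintro P (hP | hP)
  exacts [h P hP, h' P hP]

theorem PLOn.comp {f : X → Y} {g : Y → Z} {c : PLChart X} {d : PLChart Y} {e : PLChart Z}
    {S : Set (Fin c.dim → ℝ)} {S' : Set (Fin d.dim → ℝ)} (h : PLOn f c d S) (h' : PLOn g d e S') :
    PLOn (g ∘ f) c e {x | x ∈ S ∧ ∃ hx : x ∈ c.dom, ∃ y : d.dom, y.1 ∈ S' ∧
      d.toFun y = f (c.toFun ⟨x, hx⟩)} := by
  obtain ⟨T, hT, rfl, h⟩ := h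
  obtain ⟨T', hT', rfl, h'⟩ := h'
  choose! hP A hA using h
  choose! hP' A' hA' using h'
  refine ⟨image2 (fun P P' => P ∩ A P ⁻¹' P') T T', hT.image2 _ hT', ?_, ?_⟩
  · ext x
    constructor
    · rintro ⟨_, ⟨P, h, P', h', rfl⟩, hx, hx'⟩
      obtain ⟨h1, h2, h3⟩ := hA P h x hx
      exact ⟨⟨P, h, hx⟩, h1, ⟨A P x, h2⟩, ⟨P', h', hx'⟩, h3⟩
    · rintro ⟨⟨P, h, hx⟩, h1, y, ⟨P', h', hy⟩, h3⟩
      refine ⟨_, ⟨P, h, P', h', rfl⟩, hx, ?_⟩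
      obtain ⟨h1', h2, h3'⟩ := hA P h x hx
      have : (⟨A P x, h2⟩ : d.dom) = y := d.isEmbedding.injective (h3'.trans h3.symm)
      rw [mem_preimage]
      rw [← this] at hy
      exact hy
  · rintro _ ⟨P, h, P', h', rfl⟩
    refine ⟨(hP P h).inter_preimage (hP' P' h') _, (A' P').comp (A P), ?_⟩
    rintro x ⟨hx, hx'⟩
    obtain ⟨h1, h2, h3⟩ := hA P h x hx
    obtain ⟨h1', h2', h3'⟩ := hA' P' h' (A P x) hx'
    exact ⟨h1, h2', h3'.trans (congrArg g h3)⟩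

/-- Piecewise linearity in charts can be checked locally. -/
theorem PLInCharts.of_local {f : X → Y} {c : PLChart X} {d : PLChart Y}
    (h : ∀ x ∈ c.dom, ∃ N ∈ 𝓝[c.dom] x, ∃ S, PLOn f c d S ∧ S ⊆ chartPreimage f c d ∧
      N ∩ chartPreimage f c d ⊆ S) : PLInCharts f c d := by
  have key : ∃ S, PLOn f c d S ∧ S ⊆ chartPreimage f c d ∧ c.dom ∩ chartPreimage f c d ⊆ S := by
    refine c.isPolyhedron.isCompact.induction_on
      (p := fun N => ∃ S, PLOn f c d S ∧ S ⊆ chartPreimage f c d ∧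
        N ∩ chartPreimage f c d ⊆ S) ?_ ?_ ?_ ?_
    · exact ⟨∅, PLOn.empty _ _ _, by simp, by simp⟩
    · rintro s t hst ⟨S, h1, h2, h3⟩
      exact ⟨S, h1, h2, (inter_subset_inter_left _ hst).trans h3⟩
    · rintro s t ⟨S, h1, h2, h3⟩ ⟨S', h1', h2', h3'⟩
      refine ⟨S ∪ S', h1.union h1', union_subset h2 h2', ?_⟩
      rw [union_inter_distrib_right]
      exact union_subset_union h3 h3'
    · exact h
  obtain ⟨S, h1, h2, h3⟩ := key
  have : chartPreimage f c d = S := by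
    refine Subset.antisymm (fun x hx => h3 ⟨?_, hx⟩) h2
    exact hx.1
  unfold PLInCharts
  rwa [this]

/-- Composition through an intermediate chart, on the part of the domain that it sees. -/
theorem PLInCharts.comp_on {f : X → Y} {g : Y → Z} {c : PLChart X} {d : PLChart Y} {e : PLChart Z}
    (h : PLInCharts f c d) (h' : PLInCharts g d e) :
    PLOn (g ∘ f) c e (chartPreimage f c d ∩ chartPreimage (g ∘ f) c e) := by
  have := PLOn.comp h h'
  convert this using 1
  ext x
  constructor
  · rintro ⟨⟨hx, y, hy⟩, ⟨_, hx'⟩⟩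
    refine ⟨⟨hx, y, hy⟩, hx, y, ⟨y.2, ?_⟩, hy⟩
    rw [Subtype.coe_eta, hy]
    exact hx'
  · rintro ⟨h1, hx, y, ⟨_, hy⟩, hy'⟩
    refine ⟨h1, hx, ?_⟩
    rw [Subtype.coe_eta, hy'] at hy
    exact hy

theorem PLChart.continuousOn_nhds {c : PLChart X} {x : Fin c.dim → ℝ} (hx : x ∈ c.dom)
    {O : Set X} (hO : O ∈ 𝓝 (c.toFun ⟨x, hx⟩)) :
    {y | ∃ hy : y ∈ c.dom, c.toFun ⟨y, hy⟩ ∈ O} ∈ 𝓝[c.dom] x := by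
  have h1 : c.toFun ⁻¹' O ∈ 𝓝 (⟨x, hx⟩ : c.dom) := c.isEmbedding.continuous.continuousAt hO
  have h2 := (mem_nhds_subtype_iff_nhdsWithin).1 h1
  refine Filter.mem_of_superset h2 ?_
  rintro _ ⟨y, hy, rfl⟩
  exact ⟨y.2, hy⟩

/-- Piecewise linearity in the charts `c` and `e`, by composition through intermediate charts. -/
theorem PLInCharts.comp_of_local {f : X → Y} {g : Y → Z} (hf : Continuous f)
    {c : PLChart X} {e : PLChart Z}
    (h : ∀ x ∈ c.image, ∃ d : PLChart Y, d.image ∈ 𝓝 (f x) ∧ PLInCharts f c d ∧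
      PLInCharts g d e) : PLInCharts (g ∘ f) c e := by
  refine PLInCharts.of_local fun x hx => ?_
  obtain ⟨d, h1, h2, h3⟩ := h _ ⟨⟨x, hx⟩, rfl⟩
  refine ⟨_, PLChart.continuousOn_nhds hx (hf.continuousAt h1), _, h2.comp_on h3,
    inter_subset_right, ?_⟩
  exact inter_subset_inter_left _ fun y hy => hy

/-- The restriction of a chart to a smaller compact polyhedron. -/
def PLChart.restrict (c : PLChart X) (D : Set (Fin c.dim → ℝ)) (hD : IsPolyhedron D)
    (h : D ⊆ c.dom) : PLChart X where
  dim := c.dim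
  dom := D
  isPolyhedron := hD
  toFun x := c.toFun ⟨x.1, h x.2⟩
  isEmbedding := c.isEmbedding.comp (IsEmbedding.inclusion h)

theorem PLInCharts.restrict_left {f : X → Y} {c : PLChart X} {d : PLChart Y}
    (h : PLInCharts f c d) (D : Set (Fin c.dim → ℝ)) (hD : IsPolyhedron D) (hDc : D ⊆ c.dom) :
    PLInCharts f (c.restrict D hD hDc) d := by
  obtain ⟨T, hT, hS, h⟩ := h
  obtain ⟨T', hT', hP', rfl⟩ := hD
  refine ⟨image2 (· ∩ ·) T' T, hT'.image2 _ hT, ?_, ?_⟩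
  · ext x
    constructor
    · rintro ⟨_, ⟨P', h', P, hP, rfl⟩, hx', hx⟩
      have : x ∈ chartPreimage f c d := hS ▸ ⟨P, hP, hx⟩
      exact ⟨⟨P', h', hx'⟩, this.2⟩
    · rintro ⟨⟨P', h', hx'⟩, hx⟩
      have : x ∈ ⋃₀ T := hS ▸ ⟨hDc ⟨P', h', hx'⟩, hx⟩
      obtain ⟨P, hP, hx⟩ := this
      exact ⟨_, ⟨P', h', P, hP, rfl⟩, hx', hx⟩
  · rintro _ ⟨P', h', P, hP, rfl⟩
    obtain ⟨h1, A, hA⟩ := h P hP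
    refine ⟨(hP' P' h').inter h1, A, ?_⟩
    rintro x ⟨hx', hx⟩
    obtain ⟨_, h3, h4⟩ := hA x hx
    exact ⟨⟨P', h', hx'⟩, h3, h4⟩

theorem PLInCharts.restrict_right {f : X → Y} {c : PLChart X} {d : PLChart Y}
    (h : PLInCharts f c d) (D : Set (Fin d.dim → ℝ)) (hD : IsPolyhedron D) (hDd : D ⊆ d.dom) :
    PLInCharts f c (d.restrict D hD hDd) := by
  obtain ⟨T, hT, hS, h⟩ := h
  obtain ⟨T', hT', hP', rfl⟩ := hD
  choose! hP A hA using h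
  refine ⟨image2 (fun P P' => P ∩ A P ⁻¹' P') T T', hT.image2 _ hT', ?_, ?_⟩
  · ext x
    constructor
    · rintro ⟨_, ⟨P, hp, P', h', rfl⟩, hx, hx'⟩
      obtain ⟨h1, h2, h3⟩ := hA P hp x hx
      exact ⟨h1, ⟨A P x, P', h', hx'⟩, h3⟩
    · rintro ⟨hx, ⟨y, P', h', hy⟩, hxy⟩
      have : x ∈ ⋃₀ T := hS ▸ ⟨hx, ⟨_, hxy⟩⟩
      obtain ⟨P, hp, hx⟩ := this
      refine ⟨_, ⟨P, hp, P', h', rfl⟩, hx, ?_⟩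
      obtain ⟨h1, h2, h3⟩ := hA P hp x hx
      have e := congrArg Subtype.val (d.isEmbedding.injective (h3.trans hxy.symm))
      rw [mem_preimage]
      rw [show A P x = y from e]
      exact hy
  · rintro _ ⟨P, hp, P', h', rfl⟩
    refine ⟨(hP P hp).inter_preimage (hP' P' h') _, A P, ?_⟩
    rintro x ⟨hx, hx'⟩
    obtain ⟨h1, h2, h3⟩ := hA P hp x hx
    exact ⟨h1, ⟨P', h', hx'⟩, h3⟩

/-- Every point of a chart has arbitrarily small polyhedral neighbourhoods. -/
theorem PLChart.exists_small (c : PLChart X) (x : c.dom) {O : Set X} (hO : O ∈ 𝓝 (c.toFun x)) :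
    ∃ (D : Set (Fin c.dim → ℝ)) (_ : IsPolyhedron D) (hD : D ⊆ c.dom),
      (Subtype.val ⁻¹' D : Set c.dom) ∈ 𝓝 x ∧ ∀ y (hy : y ∈ D), c.toFun ⟨y, hD hy⟩ ∈ O := by
  have h1 : c.toFun ⁻¹' O ∈ 𝓝 x := c.isEmbedding.continuous.continuousAt hO
  rw [nhds_subtype, Filter.mem_comap] at h1
  obtain ⟨N, hN, hNO⟩ := h1
  obtain ⟨ε, hε, hb⟩ := Metric.nhds_basis_closedBall.mem_iff.1 hN
  have hb' : Metric.closedBall x.1 ε = Icc (fun i => x.1 i - ε) (fun i => x.1 i + ε) := by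
    ext y
    rw [Metric.mem_closedBall, dist_pi_le_iff hε.le]
    simp only [Real.dist_eq, abs_le, mem_Icc, Pi.le_def]
    constructor
    · intro h
      exact ⟨fun i => by linarith [(h i).1], fun i => by linarith [(h i).2]⟩
    · intro h i
      exact ⟨by linarith [h.1 i], by linarith [h.2 i]⟩
  refine ⟨c.dom ∩ Metric.closedBall x.1 ε,
    c.isPolyhedron.inter (hb' ▸ (isPolytope_Icc _ _).isPolyhedron), inter_subset_left, ?_, ?_⟩
  · rw [nhds_subtype, Filter.mem_comap]
    exact ⟨_, Metric.closedBall_mem_nhds _ hε, fun y hy => ⟨y.2, hy⟩⟩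
  · intro y hy
    exact hNO (show (⟨y, hy.1⟩ : c.dom) ∈ Subtype.val ⁻¹' N from hb hy.2)

theorem PLChart.compatible_refl (c : PLChart X) : c.Compatible c := by
  have : PLInCharts id c c := by
    obtain ⟨T, hT, hP, hS⟩ := c.isPolyhedron
    refine ⟨T, hT, ?_, fun P h => ⟨hP P h, AffineMap.id ℝ _, fun x hx => ?_⟩⟩
    · rw [hS]
      ext x
      exact ⟨fun hx => ⟨hx, ⟨x, hx⟩, rfl⟩, fun hx => hx.1⟩
    · have : x ∈ c.dom := hS ▸ ⟨P, h, hx⟩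
      exact ⟨this, this, rfl⟩
  exact ⟨this, this⟩

/-- The PL structure determined by one chart whose image is the whole space. -/
def PLStructure.ofChart (c₀ : PLChart X) (h₀ : c₀.image = univ) : PLStructure X where
  charts := {c | c.Compatible c₀}
  compatible c hc d hd := by
    constructor
    · exact PLInCharts.comp_of_local (f := id) (g := id) continuous_id
        fun x _ => ⟨c₀, by rw [h₀]; exact Filter.univ_mem, hc.1, hd.2⟩
    · exact PLInCharts.comp_of_local (f := id) (g := id) continuous_id
        fun x _ => ⟨c₀, by rw [h₀]; exact Filter.univ_mem, hd.1, hc.2⟩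
  cover x := ⟨c₀, c₀.compatible_refl, by rw [h₀]; exact Filter.univ_mem⟩
  maximal c hc := hc c₀ c₀.compatible_refl

end PLOn

theorem PLSpace.restrict_mem {P : PLSpace} {c : PLChart P} (hc : c ∈ P.str.charts)
    (D : Set (Fin c.dim → ℝ)) (hD : IsPolyhedron D) (h : D ⊆ c.dom) :
    c.restrict D hD h ∈ P.str.charts :=
  P.str.maximal _ fun d hd =>
    ⟨(P.str.compatible c hc d hd).1.restrict_left D hD h,
      (P.str.compatible c hc d hd).2.restrict_right D hD h⟩

/-- A point in the interior of the image of a chart has arbitrarily small chart neighbourhoods,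
obtained by restricting the given chart. -/
theorem PLSpace.exists_restrict {X : Type} [TopologicalSpace X] (c : PLChart X) {x : X}
    (hx : c.image ∈ 𝓝 x) {O : Set X} (hO : O ∈ 𝓝 x) :
    ∃ (D : Set (Fin c.dim → ℝ)) (hD : IsPolyhedron D) (h : D ⊆ c.dom),
      (c.restrict D hD h).image ∈ 𝓝 x ∧ (c.restrict D hD h).image ⊆ O := by
  obtain ⟨y, rfl⟩ := mem_of_mem_nhds hx
  obtain ⟨D, hD, h, hn, hs⟩ := c.exists_small y hO
  refine ⟨D, hD, h, ?_, ?_⟩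
  · rw [c.isEmbedding.isInducing.nhds_eq_comap, Filter.mem_comap] at hn
    obtain ⟨N, hN, hND⟩ := hn
    filter_upwards [hN, hx] with z hz hz'
    obtain ⟨w, rfl⟩ := hz'
    exact ⟨⟨w.1, hND hz⟩, rfl⟩
  · rintro _ ⟨w, rfl⟩
    exact hs w.1 w.2

/-- In the definition of a PL map, the condition on the images of the charts can be dropped. -/
theorem IsPLMap.of_charts {P Q : PLSpace} {f : P → Q} (hf : Continuous f)
    (h : ∀ x : P, ∃ c ∈ P.str.charts, ∃ d ∈ Q.str.charts,
      c.image ∈ 𝓝 x ∧ d.image ∈ 𝓝 (f x) ∧ PLInCharts f c d) : IsPLMap f := by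
  refine ⟨hf, fun x => ?_⟩
  obtain ⟨c, hc, d, hd, hcx, hdx, hcd⟩ := h x
  obtain ⟨D, hD, hDc, h1, h2⟩ := PLSpace.exists_restrict c hcx (hf.continuousAt hdx)
  exact ⟨_, PLSpace.restrict_mem hc D hD hDc, d, hd, h1, hdx, fun z hz => h2 hz,
    hcd.restrict_left D hD hDc⟩

/-- A PL map is piecewise linear with respect to all charts. -/
theorem IsPLMap.plInCharts {P Q : PLSpace} {f : P → Q} (hf : IsPLMap f) {c : PLChart P}
    (hc : c ∈ P.str.charts) {d : PLChart Q} (hd : d ∈ Q.str.charts) : PLInCharts f c d := by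
  refine PLInCharts.comp_of_local (f := id) (g := f) continuous_id fun x _ => ?_
  obtain ⟨c', hc', d', hd', hcx, hdx, hm, hcd⟩ := hf.2 x
  refine ⟨c', hcx, (P.str.compatible c hc c' hc').1, ?_⟩
  have : PLInCharts (id ∘ f) c' d := by
    have key := PLInCharts.comp_on (g := id) hcd (Q.str.compatible d' hd' d hd).1
    have hsub : chartPreimage (id ∘ f) c' d ⊆ chartPreimage f c' d' :=
      fun y hy => ⟨hy.1, hm ⟨_, rfl⟩⟩
    rwa [inter_eq_right.2 hsub] at key
  exact this

theorem IsPLMap.id (P : PLSpace) : IsPLMap (id : P → P) :=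
  IsPLMap.of_charts continuous_id fun x => by
    obtain ⟨c, hc, hx⟩ := P.str.cover x
    exact ⟨c, hc, c, hc, hx, hx, c.compatible_refl.1⟩

theorem IsPLMap.comp {P Q R : PLSpace} {g : Q → R} {f : P → Q} (hg : IsPLMap g)
    (hf : IsPLMap f) : IsPLMap (g ∘ f) :=
  IsPLMap.of_charts (hg.1.comp hf.1) fun x => by
    obtain ⟨c, hc, hx⟩ := P.str.cover x
    obtain ⟨e, he, hx'⟩ := R.str.cover (g (f x))
    refine ⟨c, hc, e, he, hx, hx', PLInCharts.comp_of_local hf.1 fun y _ => ?_⟩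
    obtain ⟨d, hd, hy⟩ := Q.str.cover (f y)
    exact ⟨d, hy, hf.plInCharts hc hd, hg.plInCharts hd he⟩

/-- The category of PL spaces and PL maps. -/
instance : Category PLSpace where
  Hom P Q := {f : P → Q // IsPLMap f}
  id P := ⟨id, IsPLMap.id P⟩
  comp f g := ⟨g.1 ∘ f.1, g.2.comp f.2⟩

/-! ### PL subspaces -/

/-- The chart of `X` obtained from a chart of a subspace. -/
def PLChart.ofSubtype {X : Type} [TopologicalSpace X] {Q : Set X} (c : PLChart Q) : PLChart X where
  dim := c.dim
  dom := c.dom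
  isPolyhedron := c.isPolyhedron
  toFun := Subtype.val ∘ c.toFun
  isEmbedding := IsEmbedding.subtypeVal.comp c.isEmbedding

/-- The chart of a subspace obtained from a chart of `X` whose image lies in the subspace. -/
def PLChart.toSubtype {X : Type} [TopologicalSpace X] {Q : Set X} (c : PLChart X)
    (h : c.image ⊆ Q) : PLChart Q where
  dim := c.dim
  dom := c.dom
  isPolyhedron := c.isPolyhedron
  toFun x := ⟨c.toFun x, h ⟨x, rfl⟩⟩
  isEmbedding := c.isEmbedding.codRestrict Q _

theorem PLInCharts.of_ofSubtype {X Y : Type} [TopologicalSpace X] [TopologicalSpace Y] {Q : Set Y}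
    {f : X → Q} {c : PLChart X} {d : PLChart Q} (h : PLInCharts (Subtype.val ∘ f) c d.ofSubtype) :
    PLInCharts f c d := by
  obtain ⟨T, hT, hS, h⟩ := h
  refine ⟨T, hT, ?_, fun P hP => ?_⟩
  · rw [hS]
    ext x
    constructor
    · rintro ⟨hx, y, hy⟩
      exact ⟨hx, y, Subtype.ext hy⟩
    · rintro ⟨hx, y, hy⟩
      exact ⟨hx, y, congrArg Subtype.val hy⟩
  · obtain ⟨h1, A, hA⟩ := h P hP
    refine ⟨h1, A, fun x hx => ?_⟩
    obtain ⟨h2, h3, h4⟩ := hA x hx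
    exact ⟨h2, h3, Subtype.ext h4⟩

theorem PLInCharts.to_ofSubtype {X Y : Type} [TopologicalSpace X] [TopologicalSpace Y] {Q : Set Y}
    {f : X → Q} {c : PLChart X} {d : PLChart Q} (h : PLInCharts f c d) :
    PLInCharts (Subtype.val ∘ f) c d.ofSubtype := by
  obtain ⟨T, hT, hS, h⟩ := h
  refine ⟨T, hT, ?_, fun P hP => ?_⟩
  · rw [hS]
    ext x
    constructor
    · rintro ⟨hx, y, hy⟩
      exact ⟨hx, y, congrArg Subtype.val hy⟩
    · rintro ⟨hx, y, hy⟩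
      exact ⟨hx, y, Subtype.ext hy⟩
  · obtain ⟨h1, A, hA⟩ := h P hP
    refine ⟨h1, A, fun x hx => ?_⟩
    obtain ⟨h2, h3, h4⟩ := hA x hx
    exact ⟨h2, h3, congrArg Subtype.val h4⟩

/-- `Q` is a PL subspace of `P`: every point of `Q` has a neighbourhood in `Q` which is the image
of a chart of `P`. -/
def PLSpace.IsPLSubspace (P : PLSpace) (Q : Set P) : Prop :=
  ∀ x ∈ Q, ∃ c ∈ P.str.charts, c.image ⊆ Q ∧ c.image ∈ 𝓝[Q] x

theorem PLSpace.IsPLSubspace.cover {P : PLSpace} {Q : Set P} (hQ : P.IsPLSubspace Q) (x : Q) :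
    ∃ d : PLChart Q, d.ofSubtype ∈ P.str.charts ∧ d.image ∈ 𝓝 x := by
  obtain ⟨d, hd, h1, h2⟩ := hQ x.1 x.2
  refine ⟨d.toSubtype h1, hd, ?_⟩
  have : (d.toSubtype h1).image = Subtype.val ⁻¹' d.image := by
    ext y
    constructor
    · rintro ⟨z, rfl⟩
      exact ⟨z, rfl⟩
    · rintro ⟨z, hz⟩
      exact ⟨z, Subtype.ext hz⟩
  rw [this]
  exact mem_nhds_subtype_iff_nhdsWithin.2
    (by rw [Subtype.image_preimage_coe]; exact Filter.inter_mem self_mem_nhdsWithin h2)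

/-- A PL subspace, as a PL space: its charts are the charts of `P` whose image lies in `Q`. -/
def PLSpace.sub (P : PLSpace) (Q : Set P) (hQ : P.IsPLSubspace Q) : PLSpace where
  carrier := Q
  str :=
    { charts := {c | c.ofSubtype ∈ P.str.charts}
      compatible := fun c hc d hd =>
        ⟨PLInCharts.of_ofSubtype (f := id) (P.str.compatible _ hc _ hd).1,
          PLInCharts.of_ofSubtype (f := id) (P.str.compatible _ hd _ hc).1⟩
      cover := hQ.cover
      maximal := fun c hc => P.str.maximal _ fun e he => by
        constructor
        · have : PLInCharts (Subtype.val ∘ id) c e :=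
            PLInCharts.comp_of_local continuous_id fun x _ => by
              obtain ⟨d, hd, hx⟩ := hQ.cover x
              exact ⟨d, hx, (hc d hd).1, (P.str.compatible _ hd e he).1⟩
          exact this
        · refine PLInCharts.of_local fun y hy => ?_
          by_cases hyc : e.toFun ⟨y, hy⟩ ∈ c.ofSubtype.image
          · obtain ⟨w, hw⟩ := hyc
            obtain ⟨d, hd, hx⟩ := hQ.cover (c.toFun w)
            rw [nhds_subtype, Filter.mem_comap] at hx
            obtain ⟨O, hO, hOd⟩ := hx
            have hO' : O ∈ 𝓝 (e.toFun ⟨y, hy⟩) := by rw [← hw]; exact hO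
            refine ⟨_, PLChart.continuousOn_nhds hy hO', _,
              PLInCharts.comp_on (f := id) (g := id) (d := d.ofSubtype)
                (P.str.compatible _ he _ hd).1
                (PLInCharts.to_ofSubtype (f := id) (hc d hd).2), inter_subset_right, ?_⟩
            rintro z ⟨⟨hz, hz'⟩, hz2⟩
            refine ⟨⟨hz, ?_⟩, hz2⟩
            obtain ⟨_, v, hv⟩ := hz2
            have hv' : (c.toFun v).1 = e.toFun ⟨z, hz⟩ := hv
            obtain ⟨u, hu⟩ := hOd (show c.toFun v ∈ Subtype.val ⁻¹' O by
              rw [mem_preimage, hv']; exact hz')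
            exact ⟨u, (congrArg Subtype.val hu).trans hv'⟩
          · refine ⟨_, PLChart.continuousOn_nhds hy (O := c.ofSubtype.imageᶜ) ?_, ∅,
              PLOn.empty _ _ _, empty_subset _, ?_⟩
            · refine IsOpen.mem_nhds ?_ hyc
              rw [isOpen_compl_iff]
              have : CompactSpace c.ofSubtype.dom := isCompact_iff_compactSpace.1 c.isPolyhedron.isCompact
              exact (isCompact_range c.ofSubtype.isEmbedding.continuous).isClosed
            · rintro z ⟨⟨hz, hz'⟩, ⟨_, hz2⟩⟩
              exact hz' hz2 }

theorem PLSpace.isPLSubspace_of_isOpen (P : PLSpace) {U : Set P} (hU : IsOpen U) :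
    P.IsPLSubspace U := by
  intro x hx
  obtain ⟨c, hc, hcx⟩ := P.str.cover x
  obtain ⟨D, hD, hDc, h1, h2⟩ := PLSpace.exists_restrict c hcx (hU.mem_nhds hx)
  exact ⟨_, PLSpace.restrict_mem hc D hD hDc, h2, mem_nhdsWithin_of_mem_nhds h1⟩

theorem PLSpace.IsPLSubspace.inter {P : PLSpace} {Q R : Set P} (hQ : P.IsPLSubspace Q)
    (hR : P.IsPLSubspace R) : P.IsPLSubspace (Q ∩ R) := by
  rintro x ⟨hxQ, hxR⟩
  obtain ⟨c, hc, h1, h2⟩ := hQ x hxQ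
  obtain ⟨d, hd, h3, h4⟩ := hR x hxR
  have hD : IsPolyhedron (chartPreimage id c d) :=
    PLOn.isPolyhedron (P.str.compatible c hc d hd).1
  have him : (c.restrict (chartPreimage id c d) hD fun x hx => hx.1).image = c.image ∩ d.image := by
    ext y
    constructor
    · rintro ⟨⟨z, hz, hz'⟩, rfl⟩
      exact ⟨⟨⟨z, hz⟩, rfl⟩, hz'⟩
    · rintro ⟨⟨z, rfl⟩, hz⟩
      exact ⟨⟨z.1, z.2, hz⟩, rfl⟩
  refine ⟨_, PLSpace.restrict_mem hc (chartPreimage id c d) hD fun x hx => hx.1, ?_, ?_⟩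
  · rw [him]
    exact inter_subset_inter h1 h3
  · rw [him]
    exact Filter.inter_mem (nhdsWithin_mono x inter_subset_left h2)
      (nhdsWithin_mono x inter_subset_right h4)

theorem PLSpace.isPLMap_val (P : PLSpace) (Q : Set P) (hQ : P.IsPLSubspace Q) :
    IsPLMap (P := P.sub Q hQ) (Q := P) (Subtype.val : Q → P) :=
  IsPLMap.of_charts continuous_subtype_val fun x => by
    obtain ⟨c, hc, hx⟩ := hQ.cover x
    obtain ⟨d, hd, hx'⟩ := P.str.cover x.1
    exact ⟨c, hc, d, hd, hx, hx', (P.str.compatible _ hc d hd).1⟩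

theorem PLSpace.isPLMap_inclusion (P : PLSpace) {Q R : Set P} (hQ : P.IsPLSubspace Q)
    (hR : P.IsPLSubspace R) (h : Q ⊆ R) :
    IsPLMap (P := P.sub Q hQ) (Q := P.sub R hR) (Set.inclusion h) :=
  IsPLMap.of_charts (continuous_inclusion h) fun x => by
    obtain ⟨c, hc, hx⟩ := hQ.cover x
    obtain ⟨d, hd, hx'⟩ := hR.cover (Set.inclusion h x)
    exact ⟨c, hc, d, hd, hx, hx', PLInCharts.of_ofSubtype (P.str.compatible _ hc _ hd).1⟩

/-- The inclusion of a PL subspace, as a morphism of PL spaces. -/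
def PLSpace.subι (P : PLSpace) (Q : Set P) (hQ : P.IsPLSubspace Q) : P.sub Q hQ ⟶ P :=
  ⟨_, P.isPLMap_val Q hQ⟩

/-- The inclusion between nested PL subspaces, as a morphism of PL spaces. -/
def PLSpace.subIncl (P : PLSpace) {Q R : Set P} (hQ : P.IsPLSubspace Q) (hR : P.IsPLSubspace R)
    (h : Q ⊆ R) : P.sub Q hQ ⟶ P.sub R hR :=
  ⟨_, P.isPLMap_inclusion hQ hR h⟩

/-! ### Geometric simplices -/

/-- The inclusion `Δᵖ ⊆ ℝᵖ⁺¹` gives a chart of the standard geometric simplex. -/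
def simplexChart (p : ℕ) : PLChart (stdSimplex ℝ (Fin (p + 1))) where
  dim := p + 1
  dom := stdSimplex ℝ (Fin (p + 1))
  isPolyhedron := (isPolytope_stdSimplex _).isPolyhedron
  toFun := id
  isEmbedding := IsEmbedding.id

theorem simplexChart_image (p : ℕ) : (simplexChart p).image = univ := range_id

/-- The standard geometric simplex `Δᵖ ⊆ ℝᵖ⁺¹`, as a PL space. -/
def PLSpace.simplex (p : ℕ) : PLSpace where
  carrier := stdSimplex ℝ (Fin (p + 1))
  str := PLStructure.ofChart (simplexChart p) (simplexChart_image p)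

theorem plInCharts_simplexChart {p q : ℕ} (η : Fin (p + 1) → Fin (q + 1)) :
    PLInCharts (stdSimplex.map η) (simplexChart p) (simplexChart q) := by
  have : chartPreimage (stdSimplex.map η) (simplexChart p) (simplexChart q) =
      stdSimplex ℝ (Fin (p + 1)) := by
    ext y
    exact ⟨fun hy => hy.1, fun hy => ⟨hy, _, rfl⟩⟩
  unfold PLInCharts
  rw [this]
  refine ⟨{stdSimplex ℝ (Fin (p + 1))}, finite_singleton _, sUnion_singleton _, ?_⟩
  rintro P rfl
  refine ⟨isPolytope_stdSimplex _, (FunOnFinite.linearMap ℝ ℝ η).toAffineMap, ?_⟩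
  intro y hy
  exact ⟨hy, stdSimplex.image_linearMap η ⟨y, hy, rfl⟩, rfl⟩

theorem isPLMap_simplex {p q : ℕ} (η : Fin (p + 1) → Fin (q + 1)) :
    IsPLMap (P := PLSpace.simplex p) (Q := PLSpace.simplex q) (stdSimplex.map η) := by
  have h : ∀ (n : ℕ) (x : stdSimplex ℝ (Fin (n + 1))), (simplexChart n).image ∈ 𝓝 x := by
    intro n x
    rw [simplexChart_image]
    exact Filter.univ_mem
  exact IsPLMap.of_charts (stdSimplex.continuous_map η) fun x =>
    ⟨simplexChart p, (simplexChart p).compatible_refl,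
      simplexChart q, (simplexChart q).compatible_refl, h p x, h q _, plInCharts_simplexChart η⟩

/-- The functor `Δ ⥤ PL` sending `[p]` to `Δᵖ` and `η` to the induced linear map. -/
noncomputable def simplexFunctor : SimplexCategory ⥤ PLSpace where
  obj n := PLSpace.simplex n.len
  map η := ⟨stdSimplex.map η, isPLMap_simplex _⟩
  map_id _ := Subtype.ext (funext fun x => stdSimplex.map_id_apply x)
  map_comp f g := Subtype.ext (funext fun x => (stdSimplex.map_comp_apply f g x).symm)

/-! ### Quasi-PL spaces -/

/-- The restriction `W_Q` of an element of `F(P)` over a PL subspace `Q` of `P`. -/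
def PLSpace.res {P : PLSpace} (F : PLSpaceᵒᵖ ⥤ Type u) {Q : Set P} (hQ : P.IsPLSubspace Q)
    (W : F.obj (op P)) : F.obj (op (P.sub Q hQ)) :=
  F.map (P.subι Q hQ).op W

/-- For a family of PL subspaces `Q i` of `P`, the diagram
`F(P) → ∏ᵢ F(Q i) ⇉ ∏ᵢⱼ F(Q i ∩ Q j)` is an equalizer diagram. -/
def GluesAlong (F : PLSpaceᵒᵖ ⥤ Type u) {P : PLSpace} {ι : Type} (Q : ι → Set P)
    (hQ : ∀ i, P.IsPLSubspace (Q i)) : Prop :=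
  ∀ W : ∀ i, F.obj (op (P.sub (Q i) (hQ i))),
    (∀ i j, F.map (P.subIncl ((hQ i).inter (hQ j)) (hQ i) inter_subset_left).op (W i) =
      F.map (P.subIncl ((hQ i).inter (hQ j)) (hQ j) inter_subset_right).op (W j)) →
    ∃! W' : F.obj (op P), ∀ i, PLSpace.res F (hQ i) W' = W i

/-- A quasi-PL space: a set-valued presheaf on PL spaces which is a sheaf for open covers and
satisfies the gluing condition for locally finite covers by closed PL subspaces. -/
structure IsQuasiPL (F : PLSpaceᵒᵖ ⥤ Type u) : Prop where
  sheaf : ∀ (P : PLSpace) (ι : Type) (U : ι → Set P) (hU : ∀ i, IsOpen (U i)),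
    ⋃ i, U i = univ → GluesAlong F U fun i => P.isPLSubspace_of_isOpen (hU i)
  gluing : ∀ (P : PLSpace) (ι : Type) (Q : ι → Set P) (hQ : ∀ i, P.IsPLSubspace (Q i)),
    (∀ i, IsClosed (Q i)) → LocallyFinite Q → ⋃ i, Q i = univ → GluesAlong F Q hQ

/-- The functor taking a presheaf on PL spaces to its underlying simplicial set
`[p] ↦ F(Δᵖ)`. -/
noncomputable def underlyingSSet : (PLSpaceᵒᵖ ⥤ Type u) ⥤ SSet.{u} :=
  (Functor.whiskeringLeft _ _ _).obj simplexFunctor.op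

/-- Every element of every `F(P)` lies locally in `F'`, for some open cover of `P`. -/
def LocallyIn {F : PLSpaceᵒᵖ ⥤ Type u} (F' : Subfunctor F) : Prop :=
  ∀ (P : PLSpace) (W : F.obj (op P)), ∃ 𝒰 : Set (Set P), ⋃₀ 𝒰 = univ ∧
    ∀ U ∈ 𝒰, ∃ hU : IsOpen U,
      PLSpace.res F (P.isPLSubspace_of_isOpen hU) W ∈ F'.obj (op (P.sub U _))

/-! ### Weak homotopy equivalences -/

/-- The map induced by a continuous map on path components. -/
def zerothHomotopyMap {X Y : Type u} [TopologicalSpace X] [TopologicalSpace Y] (f : C(X, Y)) :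
    ZerothHomotopy X → ZerothHomotopy Y :=
  ZerothHomotopy.lift (fun x => ZerothHomotopy.mk (f x))
    fun _ _ p => ZerothHomotopy.sound (p.map f.continuous)

/-- The map induced by a continuous map on homotopy groups. -/
def homotopyGroupMap {X Y : Type u} [TopologicalSpace X] [TopologicalSpace Y] (f : C(X, Y))
    (n : ℕ) (x : X) : HomotopyGroup.Pi n X x → HomotopyGroup.Pi n Y (f x) :=
  Quotient.map (fun γ => ⟨f.comp γ.1, fun y hy => congrArg f (γ.2 y hy)⟩)
    fun _ _ h => h.map fun H => H.compContinuousMap f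

/-- A weak homotopy equivalence of topological spaces: a continuous map inducing a bijection on
path components and on all homotopy groups, at all base points. -/
def IsWeakHomotopyEquiv {X Y : Type u} [TopologicalSpace X] [TopologicalSpace Y] (f : C(X, Y)) :
    Prop :=
  Function.Bijective (zerothHomotopyMap f) ∧
    ∀ (n : ℕ) (x : X), 1 ≤ n → Function.Bijective (homotopyGroupMap f n x)

/-- A weak homotopy equivalence of simplicial sets: a map whose geometric realization is a weak
homotopy equivalence. -/
def SSet.IsWeakHomotopyEquiv {X Y : SSet.{u}} (f : X ⟶ Y) : Prop :=
  _root_.IsWeakHomotopyEquiv (SSet.toTop.map f).hom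

/-! ### Monotone maps of simplices and step functions -/

section StepFunctions

open MeasureTheory

/-! Restricted to sufficiently small simplices, an element of `F(Δᵖ)` lies in `F'`. So the
realization of `F` should deform into that of `F'` by subdivision, provided that subdivision can be
made into a homotopy that is natural in all simplices and preserves the realization of `F'`.

A point of `Δᵖ` is the distribution of a monotone step function on `[0, 1)` with values in `[p]`.
Cutting `[0, 1)` into `R + 1` equal pieces gives the edgewise subdivision (`exists_edgewise`). A
`q`-simplex of it comes from a monotone `θ` on `R + 1` consecutive blocks of `q + 1` vertices; its
`k`-th vertex is the mean over the blocks `i` of the vertices `θ(i, k)`. The coordinates of the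
vertices of such a simplex differ by at most `2 / (R + 1)` (`abs_meanVertex_sub_le`).

Given `σ ∈ F(Δᵖ)`, pull it back along the affine map from a simplex with `R + 2` blocks which is `θ`
on the first `R + 1` blocks and the mean vertices on the last. Inside this single simplex, shifting
the weight of the blocks from the barycenter of the first `R + 1` to the last one joins a point of
`σ` to a point of a subdivided simplex (`joinPoint_zero`, `joinPoint_one`). The path depends only on
the starting point (`joinPoint_congr`) and is natural, so these paths form a homotopy starting at
the identity (`exists_homotopy`). Since only pullbacks of `σ` occur, it preserves the realization of
`F'` (`joinPoint_mem_range`). By the Lebesgue number lemma its end carries a given simplex into that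
realization for all large `R` (`LocallyIn.exists_affinePull_mem`).

On the topological side, equal points of a realization have a common refinement
(`related_of_point_eq`). Hence the inclusion is a closed embedding (`isClosedEmbedding_toTop_map`),
and one `R` serves a whole compact set (`exists_subset_of_isCompact`). A map of a cube with boundary
in the smaller realization is therefore deformed into it, and a reparametrization of the cylinder
makes the deformation relative to the boundary (`exists_homotopicRel_of_homotopy`). Such
compressions give the bijections on `π₀` and all `πₙ` (`isWeakHomotopyEquiv_of_compression`). -/

theorem stdSimplex.map_apply_eq_sum {X Y : Type*} [Fintype X] [Fintype Y] [DecidableEq Y]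
    (f : X → Y) (s : stdSimplex ℝ X) (y : Y) :
    stdSimplex.map f s y = ∑ x with f x = y, s x := by
  rw [stdSimplex.map_coe, FunOnFinite.linearMap_apply_apply]

/-- A monotone map is determined by its effect on a point with positive coordinates. -/
theorem monotone_eq_of_map_eq {m p : ℕ} (w : stdSimplex ℝ (Fin (m + 1))) (hw : ∀ k, 0 < w k)
    {f g : Fin (m + 1) → Fin (p + 1)} (hf : Monotone f) (hg : Monotone g)
    (h : stdSimplex.map f w = stdSimplex.map g w) : f = g := by
  classical
  have cum : ∀ (f : Fin (m + 1) → Fin (p + 1)) (a : Fin (p + 1)),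
      ∑ b with b ≤ a, stdSimplex.map f w b = ∑ k with f k ≤ a, w k := by
    intro f a
    simp_rw [stdSimplex.map_apply_eq_sum]
    rw [← Finset.sum_biUnion]
    · congr 1
      ext k
      simp
    · intro b _ b' _ hbb
      rw [Function.onFun, Finset.disjoint_left]
      intro k hk hk'
      simp only [Finset.mem_filter, Finset.mem_univ, true_and] at hk hk'
      exact hbb (hk.symm.trans hk')
  -- If `f k < g k`, monotonicity puts `{g ≤ f k}` inside `{f ≤ f k}`, and `k` lies only in the
  -- latter; since `w k > 0` the cumulative weights at `f k` then differ.
  have key : ∀ f g : Fin (m + 1) → Fin (p + 1), Monotone f → Monotone g →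
      stdSimplex.map f w = stdSimplex.map g w → ∀ k, ¬ f k < g k := by
    intro f g hf hg h k hk
    have h1 : ∑ j with f j ≤ f k, w j = ∑ j with g j ≤ f k, w j := by
      rw [← cum f, ← cum g, h]
    have h2 : ∑ j with g j ≤ f k, w j < ∑ j with f j ≤ f k, w j := by
      refine Finset.sum_lt_sum_of_subset (i := k) ?_ ?_ ?_ (hw k) fun j _ _ => (hw j).le
      · intro j hj
        simp only [Finset.mem_filter, Finset.mem_univ, true_and] at hj ⊢
        have hjk : j ≤ k := by
          by_contra hc
          exact absurd (hg (le_of_not_ge hc)) (not_le.2 (hj.trans_lt hk))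
        exact hf hjk
      · simp
      · simpa using hk
    exact absurd h1 h2.ne'
  funext k
  exact le_antisymm (not_lt.1 (key g f hg hf h.symm k)) (not_lt.1 (key f g hf hg h k))

/-- Lebesgue measure on `[0, 1)`. -/
noncomputable def unitMeasure : Measure ℝ := volume.restrict (Ico 0 1)

instance : IsProbabilityMeasure unitMeasure :=
  ⟨by simp [unitMeasure]⟩

theorem measurableSet_fiber_of_monotone {P : Type*} [PartialOrder P] {τ : ℝ → P}
    (hτ : Monotone τ) (v : P) : MeasurableSet {x | τ x = v} := by
  refine Set.OrdConnected.measurableSet ⟨fun x hx y hy z hz => ?_⟩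
  rw [mem_ofPred_eq] at hx hy ⊢
  exact le_antisymm (hy ▸ hτ hz.2) (hx ▸ hτ hz.1)

/-- A step function with values in a finite partially ordered set takes its values, up to measure
zero, on a finite chain. -/
theorem exists_chain_of_monotone {P : Type*} [PartialOrder P] [Fintype P] {τ : ℝ → P}
    (hτ : Monotone τ) :
    ∃ (m : ℕ) (w : stdSimplex ℝ (Fin (m + 1))) (c : Fin (m + 1) → P), m < Fintype.card P ∧
      (∀ k, 0 < w k) ∧ Monotone c ∧ (∀ k, ∃ y ∈ Ico (0 : ℝ) 1, τ y = c k) ∧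
      ∀ (s : P → Prop) [DecidablePred s],
        ∑ k with s (c k), w k = unitMeasure.real {x | s (τ x)} := by
  classical
  let W : P → ℝ := fun v => unitMeasure.real {x | τ x = v}
  have hsum : ∀ (s : P → Prop) [DecidablePred s],
      ∑ v with s v, W v = unitMeasure.real {x | s (τ x)} := by
    intro s _
    have : {x | s (τ x)} = ⋃ v ∈ Finset.univ.filter s, {x | τ x = v} := by
      ext x; simp
    rw [this, measureReal_biUnion_finset]
    · intro v _ v' _ hvv
      rw [Function.onFun, Set.disjoint_left]
      rintro x hx hx'
      exact hvv (hx.symm.trans hx')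
    · exact fun v _ => measurableSet_fiber_of_monotone hτ v
  -- Values of measure zero are dropped so that all weights on the chain are positive.
  let S : Finset P := Finset.univ.filter fun v => 0 < W v
  have hW0 : ∀ v, 0 ≤ W v := fun v => measureReal_nonneg
  have hsumS : ∀ (s : P → Prop) [DecidablePred s],
      ∑ v ∈ S with s v, W v = unitMeasure.real {x | s (τ x)} := by
    intro s _
    rw [← hsum s]
    refine Finset.sum_subset (fun v hv => by simp_all) fun v hv hv' => ?_
    have : ¬ 0 < W v := by
      intro h
      simp [S, h] at hv hv'
      exact hv' hv
    exact le_antisymm (not_lt.1 this) (hW0 v)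
  have hy : ∀ v ∈ S, ∃ y ∈ Ico (0 : ℝ) 1, τ y = v := by
    intro v hv
    by_contra hcon
    push Not at hcon
    have hv' : 0 < W v := (Finset.mem_filter.1 hv).2
    have : W v = 0 := by
      have h0 : unitMeasure {x | τ x = v} = 0 := by
        rw [unitMeasure, Measure.restrict_apply (measurableSet_fiber_of_monotone hτ v)]
        have : {x | τ x = v} ∩ Ico (0 : ℝ) 1 = ∅ := by
          ext x
          simp only [mem_inter_iff, mem_ofPred_eq, mem_empty_iff_false, iff_false, not_and]
          exact fun h h' => hcon x h' h
        rw [this, measure_empty]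
      simp [W, measureReal_def, h0]
    exact hv'.ne' this
  choose! y hyI hyτ using hy
  -- Sample points on the line are totally ordered, so listing them in increasing order lists the
  -- values of positive measure as a chain, although `P` is only partially ordered.
  let T : Finset ℝ := S.image y
  have hinj : Set.InjOn y S := fun v hv v' hv' h => by rw [← hyτ v hv, ← hyτ v' hv', h]
  have hcard : T.card = S.card := Finset.card_image_of_injOn hinj
  have hSne : S.Nonempty := by
    rw [Finset.nonempty_iff_ne_empty]
    intro h
    have := hsumS (fun _ => True)
    rw [h] at this
    simp at this
  obtain ⟨m, hm⟩ : ∃ m, S.card = m + 1 := ⟨S.card - 1, by have := hSne.card_pos; omega⟩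
  let e := T.orderEmbOfFin (hcard.trans hm)
  have heT : ∀ k, e k ∈ T := fun k => T.orderEmbOfFin_mem _ k
  have hτe : ∀ k, τ (e k) ∈ S ∧ y (τ (e k)) = e k := by
    intro k
    obtain ⟨v, hv, hv'⟩ := Finset.mem_image.1 (heT k)
    have : τ (e k) = v := by rw [← hv', hyτ v hv]
    rw [this]
    exact ⟨hv, hv'⟩
  have hsumc : ∀ (s : P → Prop) [DecidablePred s],
      ∑ k with s (τ (e k)), W (τ (e k)) = unitMeasure.real {x | s (τ x)} := by
    intro s _
    rw [← hsumS s]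
    refine Finset.sum_bij (fun k _ => τ (e k)) ?_ ?_ ?_ ?_
    · intro k hk
      simp only [Finset.mem_filter] at hk ⊢
      exact ⟨(hτe k).1, hk.2⟩
    · intro k _ l _ h
      apply e.injective
      rw [← (hτe k).2, ← (hτe l).2, h]
    · intro v hv
      rw [Finset.mem_filter] at hv
      have : y v ∈ Set.range e := by
        rw [Finset.range_orderEmbOfFin]
        exact Finset.mem_image_of_mem y hv.1
      obtain ⟨k, hk⟩ := this
      have hv' : τ (e k) = v := by rw [hk, hyτ v hv.1]
      refine ⟨k, ?_, hv'⟩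
      simp only [Finset.mem_filter, Finset.mem_univ, true_and, hv']
      exact hv.2
    · intro k _; rfl
  have hIe : ∀ k, e k ∈ Ico (0 : ℝ) 1 := fun k => by
    rw [← (hτe k).2]; exact hyI _ (hτe k).1
  refine ⟨m, ⟨fun k => W (τ (e k)), fun k => hW0 _, ?_⟩, fun k => τ (e k), ?_, ?_, ?_, ?_, ?_⟩
  · have := hsumc (fun _ => True)
    simpa using this
  · have := S.card_le_univ
    omega
  · exact fun k => (Finset.mem_filter.1 (hτe k).1).2
  · exact fun k l h => hτ (e.monotone h)
  · exact fun k => ⟨e k, hIe k, rfl⟩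
  · exact fun s _ => hsumc s

/-- A point of a simplex is the distribution of a step function. -/
theorem exists_step {p : ℕ} (t : stdSimplex ℝ (Fin (p + 1))) :
    ∃ τ : ℝ → Fin (p + 1), Monotone τ ∧ ∀ a, unitMeasure.real {x | τ x = a} = t a := by
  classical
  let cum : ℕ → ℝ := fun n => ∑ b : Fin (p + 1) with b.1 < n, t b
  have hmono : Monotone cum := fun n n' h =>
    Finset.sum_le_sum_of_subset_of_nonneg
      (fun b hb => by simp only [Finset.mem_filter, Finset.mem_univ, true_and] at hb ⊢; omega)
      fun b _ _ => t.2.1 b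
  have h0 : cum 0 = 0 := by simp [cum]
  have h1 : cum (p + 1) = 1 := by
    have : (Finset.univ.filter fun b : Fin (p + 1) => b.1 < p + 1) = Finset.univ := by
      ext b; simpa using Nat.lt_succ_iff.1 b.2
    simp only [cum, this]
    exact t.2.2
  have hs : ∀ a : Fin (p + 1), cum (a.1 + 1) = cum a.1 + t a := by
    intro a
    have : (Finset.univ.filter fun b : Fin (p + 1) => b.1 < a.1 + 1) =
        insert a (Finset.univ.filter fun b : Fin (p + 1) => b.1 < a.1) := by
      ext b
      simp only [Finset.mem_filter, Finset.mem_univ, true_and, Finset.mem_insert, Fin.ext_iff]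
      omega
    simp only [cum, this]
    rw [Finset.sum_insert (by simp)]
    ring
  -- The value is the last vertex whose preceding weights sum to at most `x`. For `x < 0` the search
  -- defaults to `0`, and the bound `p` caps it for `x ≥ 1`, so the function is monotone on the
  -- whole line.
  refine ⟨fun x => ⟨Nat.findGreatest (fun n => cum n ≤ x) p,
    Nat.lt_succ_of_le (Nat.findGreatest_le p)⟩, ?_, ?_⟩
  · intro x x' h
    exact Nat.findGreatest_mono (fun n hn => le_trans hn h) le_rfl
  · intro a
    have hset : {x | (⟨Nat.findGreatest (fun n => cum n ≤ x) p,
        Nat.lt_succ_of_le (Nat.findGreatest_le p)⟩ : Fin (p + 1)) = a} ∩ Ico (0 : ℝ) 1 =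
        Ico (cum a.1) (cum (a.1 + 1)) := by
      ext x
      simp only [mem_inter_iff, mem_ofPred_eq, Fin.ext_iff, Nat.findGreatest_eq_iff, mem_Ico]
      constructor
      · rintro ⟨⟨_, h3, h4⟩, h5, h6⟩
        constructor
        · by_cases ha : a.1 = 0
          · rw [ha, h0]; exact h5
          · exact h3 ha
        · by_cases ha : a.1 + 1 ≤ p
          · exact not_le.1 (h4 (Nat.lt_succ_self _) ha)
          · have : a.1 + 1 = p + 1 := by have := a.2; omega
            rw [this, h1]; exact h6
      · rintro ⟨h3, h4⟩
        refine ⟨⟨Nat.lt_succ_iff.1 a.2, fun _ => h3, ?_⟩, ?_, ?_⟩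
        · intro n hn hn' hc
          exact absurd (h4.trans_le (hmono hn)) (not_lt.2 hc)
        · exact le_trans (h0 ▸ hmono (Nat.zero_le _)) h3
        · exact lt_of_lt_of_le h4 (h1 ▸ hmono a.2)
    rw [measureReal_def, unitMeasure, Measure.restrict_apply' measurableSet_Ico, hset,
      Real.volume_Ico, hs]
    simp

/-- Any two points of simplices have a common refinement in the interior of a simplex. -/
theorem exists_common_refinement {q q' : ℕ} (s : stdSimplex ℝ (Fin (q + 1)))
    (s' : stdSimplex ℝ (Fin (q' + 1))) :
    ∃ (m : ℕ) (w : stdSimplex ℝ (Fin (m + 1))) (f : Fin (m + 1) →o Fin (q + 1))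
      (g : Fin (m + 1) →o Fin (q' + 1)), (∀ k, 0 < w k) ∧
      stdSimplex.map f w = s ∧ stdSimplex.map g w = s' := by
  classical
  obtain ⟨τ, hτ, h⟩ := exists_step s
  obtain ⟨τ', hτ', h'⟩ := exists_step s'
  -- The pair of step functions is one step function with values in the product order; the two
  -- coordinates of its chain are the refining maps.
  obtain ⟨m, w, c, -, hw, hc, -, hsum⟩ := exists_chain_of_monotone (hτ.prodMk hτ')
  refine ⟨m, w, ⟨fun k => (c k).1, fun k l hkl => (hc hkl).1⟩,
    ⟨fun k => (c k).2, fun k l hkl => (hc hkl).2⟩, hw, ?_, ?_⟩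
  · refine stdSimplex.ext (funext fun a => ?_)
    rw [stdSimplex.map_apply_eq_sum, ← h a]
    exact hsum fun v => v.1 = a
  · refine stdSimplex.ext (funext fun a => ?_)
    rw [stdSimplex.map_apply_eq_sum, ← h' a]
    exact hsum fun v => v.2 = a

end StepFunctions

/-! ### Products of simplices as blocks of a larger simplex -/

section Blocks

open MeasureTheory

/-- The dimension of the simplex with `R + 1` blocks of `q + 1` vertices. -/
abbrev blockDim (R q : ℕ) : ℕ := (R + 1) * q + R

/-- The vertices of the block simplex, in lexicographic order. -/
def blockEquiv (R q : ℕ) : Fin (R + 1) × Fin (q + 1) ≃ Fin (blockDim R q + 1) :=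
  -- This typechecks because `blockDim R q + 1` unfolds to `(R + 1) * (q + 1)`.
  finProdFinEquiv (m := R + 1) (n := q + 1)

theorem blockEquiv_val {R q : ℕ} (x : Fin (R + 1) × Fin (q + 1)) :
    (blockEquiv R q x).1 = x.2.1 + (q + 1) * x.1.1 := rfl

theorem monotone_of_blocks {R q : ℕ} {α : Type*} [Preorder α] {φ : Fin (blockDim R q + 1) → α}
    (h1 : ∀ i i' k k', i < i' → φ (blockEquiv R q (i, k)) ≤ φ (blockEquiv R q (i', k')))
    (h2 : ∀ i k k', k ≤ k' → φ (blockEquiv R q (i, k)) ≤ φ (blockEquiv R q (i, k'))) :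
    Monotone φ := by
  intro j j' hj
  obtain ⟨⟨i, k⟩, rfl⟩ := (blockEquiv R q).surjective j
  obtain ⟨⟨i', k'⟩, rfl⟩ := (blockEquiv R q).surjective j'
  rw [Fin.le_def, blockEquiv_val, blockEquiv_val] at hj
  rcases lt_trichotomy i i' with h | rfl | h
  · exact h1 i i' k k' h
  · exact h2 i k k' (Fin.le_def.2 (by simpa using hj))
  · exfalso
    have h3 : i'.1 + 1 ≤ i.1 := h
    have := Nat.mul_le_mul_left (q + 1) h3
    have := k'.2
    simp only at hj
    rw [Nat.mul_add] at *
    omega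

theorem blockEquiv_monotone_right {R q : ℕ} (i : Fin (R + 1)) :
    Monotone fun k => blockEquiv R q (i, k) := by
  intro k k' h
  rw [Fin.le_def, blockEquiv_val, blockEquiv_val]
  exact Nat.add_le_add_right h _

theorem blockEquiv_le_of_lt {R q : ℕ} {i i' : Fin (R + 1)} (h : i < i') (k k' : Fin (q + 1)) :
    blockEquiv R q (i, k) ≤ blockEquiv R q (i', k') := by
  rw [Fin.le_def, blockEquiv_val, blockEquiv_val]
  have h3 : i.1 + 1 ≤ i'.1 := h
  have := Nat.mul_le_mul_left (q + 1) h3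
  have := k.2
  simp only
  rw [Nat.mul_add] at *
  omega

/-- The inclusion of the vertices of a block. -/
def blockIncl {R q : ℕ} (i : Fin (R + 1)) : Fin (q + 1) →o Fin (blockDim R q + 1) :=
  ⟨fun k => blockEquiv R q (i, k), blockEquiv_monotone_right i⟩

/-- The map between block simplices given by a strictly monotone map of blocks and a monotone map
within the blocks. -/
def blockMap {R R' q q' : ℕ} (f : Fin (R + 1) ↪o Fin (R' + 1))
    (g : Fin (q + 1) →o Fin (q' + 1)) : Fin (blockDim R q + 1) →o Fin (blockDim R' q' + 1) where
  toFun j := blockEquiv R' q' (f ((blockEquiv R q).symm j).1, g ((blockEquiv R q).symm j).2)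
  monotone' := by
    refine monotone_of_blocks (fun i i' k k' h => ?_) fun i k k' h => ?_
    · simp only [Equiv.symm_apply_apply]
      -- Strictness of `f` matters: if two blocks were identified, their vertices would be compared
      -- by the inner coordinates, which are unrelated here.
      exact blockEquiv_le_of_lt (f.strictMono h) _ _
    · simp only [Equiv.symm_apply_apply]
      exact blockEquiv_monotone_right _ (g.monotone h)

@[simp]
theorem blockMap_blockEquiv {R R' q q' : ℕ} (f : Fin (R + 1) ↪o Fin (R' + 1))
    (g : Fin (q + 1) →o Fin (q' + 1)) (x : Fin (R + 1) × Fin (q + 1)) :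
    blockMap f g (blockEquiv R q x) = blockEquiv R' q' (f x.1, g x.2) := by
  simp [blockMap]

theorem sum_blockEquiv {R q : ℕ} (φ : Fin (blockDim R q + 1) → ℝ) :
    ∑ j, φ j = ∑ i, ∑ k, φ (blockEquiv R q (i, k)) := by
  rw [← (blockEquiv R q).sum_comp, Fintype.sum_prod_type]

/-- The product distribution on a block simplex. -/
def prodWeight {R q : ℕ} (ω : stdSimplex ℝ (Fin (R + 1))) (u : stdSimplex ℝ (Fin (q + 1))) :
    stdSimplex ℝ (Fin (blockDim R q + 1)) :=
  ⟨fun j => ω ((blockEquiv R q).symm j).1 * u ((blockEquiv R q).symm j).2,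
    fun j => mul_nonneg (ω.2.1 _) (u.2.1 _), by
      rw [sum_blockEquiv]
      simp only [Equiv.symm_apply_apply]
      simp_rw [← Finset.mul_sum, stdSimplex.sum_eq_one, mul_one, stdSimplex.sum_eq_one]⟩

@[simp]
theorem prodWeight_blockEquiv {R q : ℕ} (ω : stdSimplex ℝ (Fin (R + 1)))
    (u : stdSimplex ℝ (Fin (q + 1))) (x : Fin (R + 1) × Fin (q + 1)) :
    prodWeight ω u (blockEquiv R q x) = ω x.1 * u x.2 := by
  change ω _ * u _ = _
  rw [Equiv.symm_apply_apply]

theorem continuous_prodWeight {R q : ℕ} : Continuous fun x : stdSimplex ℝ (Fin (R + 1)) ×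
    stdSimplex ℝ (Fin (q + 1)) => prodWeight x.1 x.2 := by
  refine Continuous.subtype_mk (continuous_pi fun j => ?_) _
  exact ((continuous_apply _).comp (continuous_subtype_val.comp continuous_fst)).mul
    ((continuous_apply _).comp (continuous_subtype_val.comp continuous_snd))

/-- A product map pushes a product distribution to the product of the pushforwards. This is what
makes reindexing inside the blocks compatible with the homotopy. -/
theorem map_blockMap_prodWeight {R R' q q' : ℕ} (f : Fin (R + 1) ↪o Fin (R' + 1))
    (g : Fin (q + 1) →o Fin (q' + 1)) (ω : stdSimplex ℝ (Fin (R + 1)))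
    (u : stdSimplex ℝ (Fin (q + 1))) :
    stdSimplex.map (blockMap f g) (prodWeight ω u) =
      prodWeight (stdSimplex.map f ω) (stdSimplex.map g u) := by
  classical
  refine stdSimplex.ext (funext fun j => ?_)
  obtain ⟨⟨i, k⟩, rfl⟩ := (blockEquiv R' q').surjective j
  rw [prodWeight_blockEquiv]
  simp only [stdSimplex.map_apply_eq_sum]
  rw [Finset.sum_filter, sum_blockEquiv, Finset.sum_mul_sum, Finset.sum_filter]
  refine Finset.sum_congr rfl fun i' _ => ?_
  simp only [blockMap_blockEquiv, EmbeddingLike.apply_eq_iff_eq, Prod.mk.injEq,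
    prodWeight_blockEquiv]
  split_ifs with h
  · rw [Finset.sum_filter]
    simp [h]
  · simp [h]

/-- A single block is the product with a point mass on the factor of blocks. -/
theorem map_blockIncl {R q : ℕ} (i : Fin (R + 1)) (u : stdSimplex ℝ (Fin (q + 1))) :
    stdSimplex.map (blockIncl i) u = prodWeight (stdSimplex.vertex i) u := by
  classical
  refine stdSimplex.ext (funext fun j => ?_)
  obtain ⟨⟨i', k⟩, rfl⟩ := (blockEquiv R q).surjective j
  rw [prodWeight_blockEquiv, stdSimplex.map_apply_eq_sum, Finset.sum_filter]
  have : ∀ x, blockIncl (R := R) i x = blockEquiv R q (i', k) ↔ i = i' ∧ x = k := by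
    intro x
    change blockEquiv R q (i, x) = _ ↔ _
    rw [EmbeddingLike.apply_eq_iff_eq, Prod.mk.injEq]
  simp only [this]
  rw [stdSimplex.vertex_coe, Pi.single_apply]
  by_cases h : i = i'
  · simp [h]
  · simp [h, Ne.symm h]

/-- Cut `[0, 1)` into `R + 1` equal intervals and rescale each to `[0, 1)`; Lebesgue measure is
translation invariant and scales by the length. -/
theorem unitMeasure_real_eq_sum (E : Set ℝ) (hE : MeasurableSet E) (R : ℕ) :
    unitMeasure.real E =
      ∑ i : Fin (R + 1), ((R + 1 : ℕ) : ℝ)⁻¹ *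
        unitMeasure.real ((fun y : ℝ => (i.1 + y) / ((R + 1 : ℕ) : ℝ)) ⁻¹' E) := by
  set r : ℝ := ((R + 1 : ℕ) : ℝ) with hr
  have hr0 : 0 < r := by rw [hr]; positivity
  let J : Fin (R + 1) → Set ℝ := fun i => Ico (i.1 / r) ((i.1 + 1) / r)
  have hJ : ⋃ i, J i = Ico (0 : ℝ) 1 := by
    ext x
    simp only [J, mem_iUnion, mem_Ico, div_le_iff₀ hr0, lt_div_iff₀ hr0]
    constructor
    · rintro ⟨i, h1, h2⟩
      have h3 : (i.1 : ℝ) + 1 ≤ r := by rw [hr]; exact_mod_cast i.2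
      constructor
      · by_contra hc
        have := mul_neg_of_neg_of_pos (not_le.1 hc) hr0
        have : (0 : ℝ) ≤ i.1 := Nat.cast_nonneg _
        linarith
      · by_contra hc
        have := mul_le_mul_of_nonneg_right (not_lt.1 hc) hr0.le
        linarith
    · rintro ⟨h1, h2⟩
      have h3 : 0 ≤ x * r := mul_nonneg h1 hr0.le
      have h4 : ⌊x * r⌋₊ < R + 1 := by
        rw [Nat.floor_lt h3, ← hr]
        nlinarith
      exact ⟨⟨_, h4⟩, Nat.floor_le h3, Nat.lt_floor_add_one _⟩
  have hdisj : Pairwise fun i i' => Disjoint (J i) (J i') := by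
    have : ∀ i i' : Fin (R + 1), i < i' → Disjoint (J i) (J i') := by
      intro i i' h
      rw [Set.disjoint_left]
      rintro x ⟨_, h2⟩ ⟨h3, _⟩
      have h4 : (i.1 : ℝ) + 1 ≤ i'.1 := by exact_mod_cast h
      have := (div_le_div_iff_of_pos_right hr0).2 h4
      linarith
    intro i i' h
    rcases lt_or_gt_of_ne h with h | h
    · exact this _ _ h
    · exact (this _ _ h).symm
  have h1 : unitMeasure.real E = ∑ i, volume.real (E ∩ J i) := by
    rw [measureReal_def, unitMeasure, Measure.restrict_apply hE, ← hJ, inter_iUnion,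
      measure_iUnion (fun i i' h => (hdisj h).mono inter_subset_right inter_subset_right)
        fun i => hE.inter measurableSet_Ico, tsum_fintype, ENNReal.toReal_sum]
    · rfl
    · intro i _
      exact ((measure_mono inter_subset_right).trans_lt (by simp [J])).ne
  rw [h1]
  refine Finset.sum_congr rfl fun i _ => ?_
  have h2 : ((fun y : ℝ => (i.1 + y) / r) ⁻¹' E) ∩ Ico (0 : ℝ) 1 =
      (fun y : ℝ => (i.1 : ℝ) + y) ⁻¹' ((fun z : ℝ => r⁻¹ * z) ⁻¹' (E ∩ J i)) := by
    ext y
    simp only [J, mem_inter_iff, mem_preimage, mem_Ico, ← div_eq_inv_mul,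
      div_le_div_iff_of_pos_right hr0, div_lt_div_iff_of_pos_right hr0]
    constructor <;> rintro ⟨h, h', h''⟩ <;> exact ⟨h, by linarith, by linarith⟩
  rw [measureReal_def (μ := unitMeasure), unitMeasure,
    Measure.restrict_apply' measurableSet_Ico, h2, measure_preimage_add,
    Real.volume_preimage_mul_left (inv_ne_zero hr0.ne'), inv_inv, ENNReal.toReal_mul,
    ENNReal.toReal_ofReal (abs_nonneg _), abs_of_pos hr0, ← mul_assoc, inv_mul_cancel₀ hr0.ne',
    one_mul, measureReal_def]

/-- Every point of a simplex lies in a simplex of the edgewise subdivision into `R + 1` blocks. -/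
theorem exists_edgewise {p : ℕ} (R : ℕ) (t : stdSimplex ℝ (Fin (p + 1))) :
    ∃ (q : Fin (Fintype.card (Fin (R + 1) → Fin (p + 1)))) (u : stdSimplex ℝ (Fin (q.1 + 1)))
      (θ : Fin (blockDim R q.1 + 1) →o Fin (p + 1)),
      stdSimplex.map θ (prodWeight stdSimplex.barycenter u) = t := by
  classical
  obtain ⟨τ, hτ, ht⟩ := exists_step t
  set r : ℝ := ((R + 1 : ℕ) : ℝ) with hr
  have hr0 : 0 < r := by rw [hr]; positivity
  -- Reading the step function on all `R + 1` subintervals at once gives a monotone map to the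
  -- product order on `[p]^(R+1)`. Its chain of values supplies `θ`, and the measures of the steps
  -- supply `u`.
  have hmono : Monotone fun (y : ℝ) (i : Fin (R + 1)) => τ ((i.1 + y) / r) := by
    intro y y' h i
    exact hτ (by gcongr)
  obtain ⟨q, u, c, hq, -, hc, hcy, hsum⟩ := exists_chain_of_monotone hmono
  let θ : Fin (blockDim R q + 1) → Fin (p + 1) := fun j =>
    c ((blockEquiv R q).symm j).2 ((blockEquiv R q).symm j).1
  have hθ : ∀ i k, θ (blockEquiv R q (i, k)) = c k i := fun i k => by simp [θ]
  refine ⟨⟨q, hq⟩, u, ⟨θ, monotone_of_blocks (fun i i' k k' h => ?_) fun i k k' h => ?_⟩, ?_⟩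
  · rw [hθ, hθ]
    -- The values are attained at `y, z` in `[0, 1)`, so `i < i'` forces `i + y ≤ i' + z`: values in
    -- an earlier block never exceed those in a later one.
    obtain ⟨y, hy, hyc⟩ := hcy k
    obtain ⟨z, hz, hzc⟩ := hcy k'
    rw [← hyc, ← hzc]
    refine hτ ?_
    have h4 : (i.1 : ℝ) + 1 ≤ i'.1 := by exact_mod_cast h
    rw [div_le_div_iff_of_pos_right hr0]
    linarith [hy.2, hz.1]
  · rw [hθ, hθ]
    exact hc h i
  · refine stdSimplex.ext (funext fun a => ?_)
    rw [stdSimplex.map_apply_eq_sum, Finset.sum_filter, sum_blockEquiv, ← ht a,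
      unitMeasure_real_eq_sum _ (measurableSet_fiber_of_monotone hτ a) R]
    refine Finset.sum_congr rfl fun i _ => ?_
    have h1 := hsum fun v => v i = a
    change _ = _ * unitMeasure.real {x | τ ((i.1 + x) / r) = a}
    rw [← h1, Finset.mul_sum, Finset.sum_filter]
    refine Finset.sum_congr rfl fun k _ => ?_
    change (if θ (blockEquiv R q (i, k)) = a then _ else _) = _
    rw [hθ, prodWeight_blockEquiv]
    split_ifs
    · congr 1
      exact (stdSimplex.barycenter_apply i).trans (by simp)
    · rfl

end Blocks

/-! ### Affine maps of simplices -/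

section Affine

/-- The affine map of simplices with the given images of the vertices. -/
noncomputable def simplexAffine {m p : ℕ} (V : Fin (m + 1) → stdSimplex ℝ (Fin (p + 1)))
    (t : stdSimplex ℝ (Fin (m + 1))) : stdSimplex ℝ (Fin (p + 1)) :=
  ⟨∑ k, t k • (V k).1, (convex_stdSimplex ℝ _).sum_mem (fun k _ => t.2.1 k) t.2.2
    fun k _ => (V k).2⟩

theorem simplexAffine_apply {m p : ℕ} (V : Fin (m + 1) → stdSimplex ℝ (Fin (p + 1)))
    (t : stdSimplex ℝ (Fin (m + 1))) (a : Fin (p + 1)) :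
    simplexAffine V t a = ∑ k, t k * V k a := by
  change (∑ k, t k • (V k).1) a = _
  rw [Finset.sum_apply]
  rfl

theorem simplexAffine_vertex {m p : ℕ} (f : Fin (m + 1) → Fin (p + 1)) :
    simplexAffine (fun k => stdSimplex.vertex (f k)) = stdSimplex.map f := by
  classical
  funext t
  refine stdSimplex.ext (funext fun a => ?_)
  rw [simplexAffine_apply, stdSimplex.map_apply_eq_sum, Finset.sum_filter]
  refine Finset.sum_congr rfl fun k _ => ?_
  rw [stdSimplex.vertex_coe, Pi.single_apply]
  simp [eq_comm]

theorem simplexAffine_map {l m p : ℕ} (V : Fin (m + 1) → stdSimplex ℝ (Fin (p + 1)))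
    (f : Fin (l + 1) → Fin (m + 1)) (t : stdSimplex ℝ (Fin (l + 1))) :
    simplexAffine V (stdSimplex.map f t) = simplexAffine (V ∘ f) t := by
  classical
  refine stdSimplex.ext (funext fun a => ?_)
  rw [simplexAffine_apply, simplexAffine_apply]
  simp only [stdSimplex.map_apply_eq_sum, Finset.sum_mul, Function.comp]
  rw [← Finset.sum_fiberwise (g := f)]
  refine Finset.sum_congr rfl fun k _ => Finset.sum_congr rfl fun j hj => ?_
  rw [(Finset.mem_filter.1 hj).2]

theorem map_simplexAffine {m p p' : ℕ} (V : Fin (m + 1) → stdSimplex ℝ (Fin (p + 1)))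
    (κ : Fin (p + 1) → Fin (p' + 1)) (t : stdSimplex ℝ (Fin (m + 1))) :
    stdSimplex.map κ (simplexAffine V t) = simplexAffine (stdSimplex.map κ ∘ V) t := by
  classical
  refine stdSimplex.ext (funext fun a => ?_)
  rw [simplexAffine_apply, stdSimplex.map_apply_eq_sum]
  simp only [stdSimplex.map_apply_eq_sum, simplexAffine_apply, Finset.mul_sum, Function.comp]
  exact Finset.sum_comm

/-- The difference from `V 0` is a convex combination of the differences `V k - V 0`, and the metric
is the sup metric of the coordinates. -/
theorem dist_simplexAffine_le {m p : ℕ} (V : Fin (m + 1) → stdSimplex ℝ (Fin (p + 1)))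
    {δ : ℝ} (h : ∀ k a, |V k a - V 0 a| ≤ δ) (t : stdSimplex ℝ (Fin (m + 1))) :
    dist (simplexAffine V t) (V 0) ≤ δ := by
  have hδ : 0 ≤ δ := (abs_nonneg _).trans (h 0 0)
  rw [Subtype.dist_eq, dist_pi_le_iff hδ]
  intro a
  rw [Real.dist_eq]
  change |simplexAffine V t a - V 0 a| ≤ δ
  have h1 : simplexAffine V t a - V 0 a = ∑ k, t k * (V k a - V 0 a) := by
    rw [simplexAffine_apply]
    simp_rw [mul_sub]
    rw [Finset.sum_sub_distrib, ← Finset.sum_mul, stdSimplex.sum_eq_one, one_mul]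
  rw [h1]
  calc |∑ k, t k * (V k a - V 0 a)| ≤ ∑ k, |t k * (V k a - V 0 a)| :=
        Finset.abs_sum_le_sum_abs _ _
    _ ≤ ∑ k, t k * δ := Finset.sum_le_sum fun k _ => by
        rw [abs_mul, abs_of_nonneg (stdSimplex.zero_le t k)]
        exact mul_le_mul_of_nonneg_left (h k a) (t.2.1 k)
    _ = δ := by rw [← Finset.sum_mul, stdSimplex.sum_eq_one, one_mul]

/-! ### Edgewise subdivision: vertices, mesh and joins -/

/-- The vertices of a simplex of the edgewise subdivision. -/
noncomputable def meanVertex {R q p : ℕ} (θ : Fin (blockDim R q + 1) → Fin (p + 1))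
    (k : Fin (q + 1)) : stdSimplex ℝ (Fin (p + 1)) :=
  stdSimplex.map (fun i => θ (blockEquiv R q (i, k))) stdSimplex.barycenter

theorem meanVertex_apply {R q p : ℕ} (θ : Fin (blockDim R q + 1) → Fin (p + 1))
    (k : Fin (q + 1)) (a : Fin (p + 1)) : meanVertex θ k a =
      ((Finset.univ.filter fun i => θ (blockEquiv R q (i, k)) = a).card : ℝ) / (R + 1 : ℕ) := by
  rw [meanVertex, stdSimplex.map_apply_eq_sum]
  have : ∀ i, (stdSimplex.barycenter : stdSimplex ℝ (Fin (R + 1))) i = ((R + 1 : ℕ) : ℝ)⁻¹ :=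
    fun i => (stdSimplex.barycenter_apply i).trans (by simp)
  simp only [this, Finset.sum_const, nsmul_eq_mul, div_eq_mul_inv]

/-- All of block `i - 1` precedes block `i`. So if `θ(i, k)` lies in the lower set `s` and `i ≠ 0`,
then so does `θ(i - 1, k')`; the shift `i ↦ i - 1` is injective away from `0`, which costs the extra
`1`. -/
theorem card_blocks_le {R q p : ℕ} (θ : Fin (blockDim R q + 1) →o Fin (p + 1))
    (s : Set (Fin (p + 1))) [DecidablePred (· ∈ s)] (hs : IsLowerSet s) (k k' : Fin (q + 1)) :
    (Finset.univ.filter fun i => θ (blockEquiv R q (i, k)) ∈ s).card ≤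
      (Finset.univ.filter fun i => θ (blockEquiv R q (i, k')) ∈ s).card + 1 := by
  set S := Finset.univ.filter fun i => θ (blockEquiv R q (i, k)) ∈ s
  have h1 : (S.erase 0).card ≤
      (Finset.univ.filter fun i => θ (blockEquiv R q (i, k')) ∈ s).card := by
    have hlt : ∀ i : Fin (R + 1), i.1 - 1 < R + 1 := fun i => by omega
    refine Finset.card_le_card_of_injOn (fun i => ⟨i.1 - 1, hlt i⟩) ?_ ?_
    · intro i hi
      simp only [Finset.coe_erase, S, Finset.coe_filter, Finset.mem_univ, true_and, mem_sdiff,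
        mem_ofPred_eq, mem_singleton_iff] at hi ⊢
      refine hs (θ.monotone (blockEquiv_le_of_lt ?_ _ _)) hi.1
      have := Fin.val_ne_of_ne hi.2
      rw [Fin.lt_def]
      simp only [Fin.val_zero] at this ⊢
      omega
    · intro i hi i' hi' h
      simp only [Finset.coe_erase, mem_sdiff, mem_singleton_iff, Fin.ext_iff, Fin.val_zero] at hi hi' h ⊢
      omega
  have := Finset.pred_card_le_card_erase (s := S) (a := 0)
  omega

/-- The number of blocks with value `a` is a difference of counts for the lower sets `Iic a` and
`Iio a`. Each count varies by at most `1` with `k`, whence the constant `2`; dividing by the number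
of blocks bounds the mesh. -/
theorem abs_meanVertex_sub_le {R q p : ℕ} (θ : Fin (blockDim R q + 1) →o Fin (p + 1))
    (k k' : Fin (q + 1)) (a : Fin (p + 1)) :
    |meanVertex θ k a - meanVertex θ k' a| ≤ 2 / (R + 1 : ℕ) := by
  classical
  have hr0 : (0 : ℝ) < ((R + 1 : ℕ) : ℝ) := by positivity
  rw [meanVertex_apply, meanVertex_apply, ← sub_div, abs_div, abs_of_pos hr0]
  refine div_le_div_of_nonneg_right ?_ hr0.le
  have hsplit : ∀ k, (Finset.univ.filter fun i => θ (blockEquiv R q (i, k)) ∈ Iic a).card =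
      (Finset.univ.filter fun i => θ (blockEquiv R q (i, k)) ∈ Iio a).card +
      (Finset.univ.filter fun i => θ (blockEquiv R q (i, k)) = a).card := by
    intro k
    rw [← Finset.card_union_of_disjoint]
    · congr 1
      ext i
      simp [le_iff_lt_or_eq]
    · rw [Finset.disjoint_left]
      intro i hi hi'
      simp only [Finset.mem_filter, mem_Iio] at hi hi'
      exact hi.2.ne hi'.2
  have h1 := card_blocks_le θ (Iic a) (isLowerSet_Iic a) k k'
  have h2 := card_blocks_le θ (Iic a) (isLowerSet_Iic a) k' k
  have h3 := card_blocks_le θ (Iio a) (isLowerSet_Iio a) k k'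
  have h4 := card_blocks_le θ (Iio a) (isLowerSet_Iio a) k' k
  have h5 := hsplit k
  have h6 := hsplit k'
  rw [abs_le]
  generalize (Finset.univ.filter fun i => θ (blockEquiv R q (i, k)) = a).card = x at *
  generalize (Finset.univ.filter fun i => θ (blockEquiv R q (i, k')) = a).card = y at *
  have h7 : x ≤ y + 2 := by omega
  have h8 : y ≤ x + 2 := by omega
  have h7' : (x : ℝ) ≤ y + 2 := by exact_mod_cast h7
  have h8' : (y : ℝ) ≤ x + 2 := by exact_mod_cast h8
  constructor <;> linarith

/-- The vertices of the join of a block simplex and the corresponding simplex of the edgewise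
subdivision. -/
noncomputable def joinVertex {R q p : ℕ} (θ : Fin (blockDim R q + 1) → Fin (p + 1))
    (j : Fin (blockDim (R + 1) q + 1)) : stdSimplex ℝ (Fin (p + 1)) :=
  Fin.lastCases (motive := fun _ => stdSimplex ℝ (Fin (p + 1)))
    (meanVertex θ ((blockEquiv (R + 1) q).symm j).2)
    (fun i => stdSimplex.vertex (θ (blockEquiv R q (i, ((blockEquiv (R + 1) q).symm j).2))))
    ((blockEquiv (R + 1) q).symm j).1

theorem joinVertex_last {R q p : ℕ} (θ : Fin (blockDim R q + 1) → Fin (p + 1))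
    (k : Fin (q + 1)) :
    joinVertex θ (blockEquiv (R + 1) q (Fin.last (R + 1), k)) = meanVertex θ k := by
  simp [joinVertex]

theorem joinVertex_castSucc {R q p : ℕ} (θ : Fin (blockDim R q + 1) → Fin (p + 1))
    (i : Fin (R + 1)) (k : Fin (q + 1)) :
    joinVertex θ (blockEquiv (R + 1) q (i.castSucc, k)) =
      stdSimplex.vertex (θ (blockEquiv R q (i, k))) := by
  simp [joinVertex]

/-- Means are taken over the blocks, so they commute with reindexing inside the blocks. -/
theorem joinVertex_comp_blockMap {R q q' p : ℕ} (θ : Fin (blockDim R q + 1) → Fin (p + 1))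
    (g : Fin (q' + 1) →o Fin (q + 1)) :
    joinVertex θ ∘ blockMap (RelEmbedding.refl _) g =
      joinVertex (θ ∘ blockMap (RelEmbedding.refl _) g) := by
  funext j
  obtain ⟨⟨i, k⟩, rfl⟩ := (blockEquiv (R + 1) q').surjective j
  rw [Function.comp_apply, blockMap_blockEquiv]
  induction i using Fin.lastCases with
  | last =>
    simp only [RelEmbedding.refl_apply, joinVertex_last, meanVertex, Function.comp,
      blockMap_blockEquiv]
  | cast i =>
    simp only [RelEmbedding.refl_apply, joinVertex_castSucc, Function.comp, blockMap_blockEquiv]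

/-- The maps induced on simplices are affine and hence preserve means; this gives naturality of the
homotopy in the simplex. -/
theorem map_comp_joinVertex {R q p p' : ℕ} (θ : Fin (blockDim R q + 1) → Fin (p + 1))
    (κ : Fin (p + 1) → Fin (p' + 1)) :
    stdSimplex.map κ ∘ joinVertex θ = joinVertex (κ ∘ θ) := by
  funext j
  obtain ⟨⟨i, k⟩, rfl⟩ := (blockEquiv (R + 1) q).surjective j
  rw [Function.comp_apply]
  induction i using Fin.lastCases with
  | last =>
    rw [joinVertex_last, joinVertex_last, meanVertex, stdSimplex.map_comp_apply]
    rfl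
  | cast i =>
    rw [joinVertex_castSucc, joinVertex_castSucc, stdSimplex.map_vertex]
    rfl

theorem joinVertex_comp_blockMap_castSucc {R q p : ℕ}
    (θ : Fin (blockDim R q + 1) → Fin (p + 1)) :
    joinVertex θ ∘ blockMap Fin.castSuccOrderEmb OrderHom.id =
      fun j => stdSimplex.vertex (θ j) := by
  funext j
  obtain ⟨⟨i, k⟩, rfl⟩ := (blockEquiv R q).surjective j
  rw [Function.comp_apply, blockMap_blockEquiv]
  exact joinVertex_castSucc θ i k

/-- The path in the simplex of blocks from the barycenter of the first blocks to the last block. -/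
noncomputable def blockPath (R : ℕ) (l : unitInterval) : stdSimplex ℝ (Fin (R + 1 + 1)) :=
  ⟨(1 - l.1) • (stdSimplex.map Fin.castSucc (stdSimplex.barycenter (X := Fin (R + 1)))).1 +
    l.1 • (stdSimplex.vertex (Fin.last (R + 1))).1,
    convex_stdSimplex ℝ _ (Subtype.prop _) (Subtype.prop _) (sub_nonneg.2 l.2.2) l.2.1 (by ring)⟩

theorem continuous_blockPath (R : ℕ) : Continuous (blockPath R) := by
  refine Continuous.subtype_mk ?_ _
  fun_prop

theorem blockPath_zero (R : ℕ) : blockPath R 0 =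
    stdSimplex.map Fin.castSucc (stdSimplex.barycenter (X := Fin (R + 1))) := by
  refine Subtype.ext ?_
  simp [blockPath]

theorem blockPath_one (R : ℕ) : blockPath R 1 = stdSimplex.vertex (Fin.last (R + 1)) := by
  refine Subtype.ext ?_
  simp [blockPath]

end Affine

/-! ### Points of geometric realizations -/

namespace Realization

/-- The simplices of a simplicial set, by dimension. -/
abbrev Simp (X : SSet.{u}) (n : ℕ) : Type u :=
  X.obj (op (SimplexCategory.mk n))

variable {X : SSet.{u}}

/-- The pullback of a simplex along a monotone map. -/
def pull {m n : ℕ} (f : Fin (m + 1) →o Fin (n + 1)) (σ : Simp X n) : Simp X m :=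
  X.map (SimplexCategory.mkHom f).op σ

theorem pull_pull {l m n : ℕ} (f : Fin (l + 1) →o Fin (m + 1)) (g : Fin (m + 1) →o Fin (n + 1))
    (σ : Simp X n) : pull f (pull g σ) = pull (g.comp f) σ := by
  have : SimplexCategory.mkHom (g.comp f) =
    SimplexCategory.mkHom f ≫ SimplexCategory.mkHom g := rfl
  rw [pull, pull, pull, this, op_comp, Functor.map_comp]
  rfl

theorem pull_id {n : ℕ} (σ : Simp X n) : pull OrderHom.id σ = σ := by
  have : SimplexCategory.mkHom (OrderHom.id) = 𝟙 (SimplexCategory.mk n) := rfl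
  rw [pull, this, op_id, X.map_id]
  rfl

/-- The point of the geometric realization with given coordinates in a given simplex. -/
noncomputable def point {n : ℕ} (σ : Simp X n) (t : stdSimplex ℝ (Fin (n + 1))) : SSet.toTop.obj X :=
  TopCat.toSSetObjEquiv (SSet.toTop.obj X) (op (SimplexCategory.mk n))
    ((sSetTopAdj.unit.app X).app _ σ) t

theorem continuous_point {n : ℕ} (σ : Simp X n) : Continuous (point σ) :=
  (TopCat.toSSetObjEquiv (SSet.toTop.obj X) (op (SimplexCategory.mk n))
    ((sSetTopAdj.unit.app X).app _ σ)).continuous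

theorem point_pull {m n : ℕ} (f : Fin (m + 1) →o Fin (n + 1)) (σ : Simp X n)
    (t : stdSimplex ℝ (Fin (m + 1))) : point (pull f σ) t = point σ (stdSimplex.map f t) := by
  unfold point pull
  have := ConcreteCategory.congr_hom
    ((sSetTopAdj.unit.app X).naturality (SimplexCategory.mkHom f).op) σ
  have h2 := TopCat.toSSetObjEquiv_naturality_apply (X := SSet.toTop.obj X) (SimplexCategory.mkHom f)
    ((sSetTopAdj.unit.app X).app _ σ) t
  refine Eq.trans ?_ h2
  exact congrArg (fun s => TopCat.toSSetObjEquiv (SSet.toTop.obj X) (op (SimplexCategory.mk m)) s t) this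

/-- The action of a map of simplicial sets on simplices. -/
def mapSimp {Y : SSet.{u}} (φ : X ⟶ Y) {n : ℕ} (σ : Simp X n) : Simp Y n :=
  φ.app (op (SimplexCategory.mk n)) σ

theorem toTop_map_point {Y : SSet.{u}} (φ : X ⟶ Y) {n : ℕ} (σ : Simp X n)
    (t : stdSimplex ℝ (Fin (n + 1))) :
    SSet.toTop.map φ (point σ t) = point (mapSimp φ σ) t := by
  have h := sSetTopAdj.unit.naturality φ
  have h2 := ConcreteCategory.congr_hom (NatTrans.congr_app h (op (SimplexCategory.mk n))) σ
  unfold point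
  refine Eq.trans ?_ (congrArg (fun s => TopCat.toSSetObjEquiv (SSet.toTop.obj Y)
    (op (SimplexCategory.mk n)) s t) h2.symm)
  rfl

/-- Maps out of the geometric realization. -/
theorem exists_desc (Y : Type u) [TopologicalSpace Y]
    (φ : ∀ n, Simp X n → C(stdSimplex ℝ (Fin (n + 1)), Y))
    (h : ∀ {m n : ℕ} (f : Fin (m + 1) →o Fin (n + 1)) (σ : Simp X n) t,
      φ m (pull f σ) t = φ n σ (stdSimplex.map f t)) :
    ∃ g : C(SSet.toTop.obj X, Y), ∀ n (σ : Simp X n) t, g (point σ t) = φ n σ t := by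
  let ψ : X ⟶ TopCat.toSSet.obj (TopCat.of Y) :=
    { app := fun n => TypeCat.ofHom fun σ =>
        (TopCat.toSSetObjEquiv (TopCat.of Y) n).symm (φ n.unop.len σ)
      naturality := by
        intro n m f
        ext σ
        apply (TopCat.toSSetObjEquiv (TopCat.of Y) m).injective
        ext t
        exact h f.unop.toOrderHom σ t }
  refine ⟨((sSetTopAdj.homEquiv X (TopCat.of Y)).symm ψ).hom, fun n σ t => ?_⟩
  have h1 : sSetTopAdj.unit.app X ≫ TopCat.toSSet.map ((sSetTopAdj.homEquiv X (TopCat.of Y)).symm ψ)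
      = ψ :=
    (sSetTopAdj.homEquiv_unit _ _ _).symm.trans (Equiv.apply_symm_apply _ _)
  have h2 := ConcreteCategory.congr_hom (NatTrans.congr_app h1 (op (SimplexCategory.mk n))) σ
  exact congrArg (fun s => TopCat.toSSetObjEquiv (TopCat.of Y)
    (op (SimplexCategory.mk n)) s t) h2

theorem hom_ext {Y : Type u} [TopologicalSpace Y] {f g : C(SSet.toTop.obj X, Y)}
    (h : ∀ n (σ : Simp X n) t, f (point σ t) = g (point σ t)) : f = g := by
  have : (TopCat.ofHom f : SSet.toTop.obj X ⟶ TopCat.of Y) = TopCat.ofHom g := by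
    apply (sSetTopAdj.homEquiv X (TopCat.of Y)).injective
    ext n σ
    apply (TopCat.toSSetObjEquiv (TopCat.of Y) n).injective
    ext t
    rw [Adjunction.homEquiv_unit, Adjunction.homEquiv_unit]
    exact h n.unop.len σ t
  exact congrArg TopCat.Hom.hom this

/-! ### Equality of points and the quotient topology of a realization -/

/-- The disjoint union of all simplices of a simplicial set. -/
abbrev Cell (X : SSet.{u}) : Type u :=
  Σ s : (Σ n, Simp X n), stdSimplex ℝ (Fin (s.1 + 1))

/-- Two pairs of a simplex and a point of it have a common refinement. -/
def Related (a b : Cell X) : Prop :=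
  ∃ (m : ℕ) (w : stdSimplex ℝ (Fin (m + 1))) (f : Fin (m + 1) →o Fin (a.1.1 + 1))
    (g : Fin (m + 1) →o Fin (b.1.1 + 1)), (∀ k, 0 < w k) ∧ stdSimplex.map f w = a.2 ∧
    stdSimplex.map g w = b.2 ∧ pull f a.1.2 = pull g b.1.2

theorem map_comp {l m n : ℕ} (f : Fin (l + 1) →o Fin (m + 1)) (g : Fin (m + 1) →o Fin (n + 1))
    (t : stdSimplex ℝ (Fin (l + 1))) :
    stdSimplex.map (g.comp f) t = stdSimplex.map g (stdSimplex.map f t) :=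
  (stdSimplex.map_comp_apply f g t).symm

theorem orderHom_eq_of_map_eq {m p : ℕ} {w : stdSimplex ℝ (Fin (m + 1))} (hw : ∀ k, 0 < w k)
    {f g : Fin (m + 1) →o Fin (p + 1)} (h : stdSimplex.map f w = stdSimplex.map g w) : f = g :=
  OrderHom.ext _ _ (monotone_eq_of_map_eq w hw f.monotone g.monotone h)

/-- Refine the two refinements once more by an interior point. Both composites to the middle simplex
then send it to the same point, and a monotone map is determined by the image of an interior point,
so the composites agree. -/
theorem Related.trans {a b c : Cell X} (h : Related a b)
    (h' : Related b c) : Related a c := by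
  obtain ⟨m, w, f, g, hw, h1, h2, h3⟩ := h
  obtain ⟨m', w', f', g', hw', h1', h2', h3'⟩ := h'
  obtain ⟨l, z, φ, ψ, hz, h4, h5⟩ := exists_common_refinement w w'
  have h6 : g.comp φ = f'.comp ψ :=
    orderHom_eq_of_map_eq hz (by rw [map_comp, map_comp, h4, h5, h2, h1'])
  refine ⟨l, z, f.comp φ, g'.comp ψ, hz, ?_, ?_, ?_⟩
  · rw [map_comp, h4, h1]
  · rw [map_comp, h5, h2']
  · rw [← pull_pull, h3, pull_pull, h6, ← pull_pull, h3', pull_pull]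

theorem related_pull {m n : ℕ} (f : Fin (m + 1) →o Fin (n + 1)) (σ : Simp X n)
    (t : stdSimplex ℝ (Fin (m + 1))) :
    Related (X := X) ⟨⟨m, pull f σ⟩, t⟩ ⟨⟨n, σ⟩, stdSimplex.map f t⟩ := by
  -- Used only to write `t` as the image of an interior point.
  obtain ⟨l, z, φ, -, hz, h4, -⟩ := exists_common_refinement t t
  refine ⟨l, z, φ, f.comp φ, hz, h4, ?_, pull_pull _ _ _⟩
  rw [map_comp, h4]

/-- Pairs of a simplex and a point of it, up to common refinement. -/
def relatedSetoid (X : SSet.{u}) : Setoid (Cell X) where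
  r := Related
  iseqv :=
    { refl := fun a => by
        have := related_pull OrderHom.id a.1.2 a.2
        rw [pull_id] at this
        simpa using this
      symm := fun ⟨m, w, f, g, hw, h1, h2, h3⟩ => ⟨m, w, g, f, hw, h2, h1, h3.symm⟩
      trans := Related.trans }

/-- The maps from single simplices to the quotient are compatible with pullback, so the universal
property of the realization glues them. Applying this map detects when two points are equal. -/
theorem exists_section_of_point : ∃ g : C(SSet.toTop.obj X, Quotient (relatedSetoid X)),
    ∀ n (σ : Simp X n) t, g (point σ t) = Quotient.mk (relatedSetoid X) ⟨⟨n, σ⟩, t⟩ := by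
  refine exists_desc _ (fun n σ => ⟨fun t => Quotient.mk (relatedSetoid X) ⟨⟨n, σ⟩, t⟩, ?_⟩) ?_
  · exact continuous_quotient_mk'.comp
      (continuous_sigmaMk (σ := fun s : (Σ n, Simp X n) => stdSimplex ℝ (Fin (s.1 + 1)))
        (i := ⟨n, σ⟩))
  · intro m n f σ t
    exact Quotient.sound (related_pull f σ t)

theorem related_of_point_eq {m n : ℕ} {σ : Simp X m} {τ : Simp X n}
    {s : stdSimplex ℝ (Fin (m + 1))} {t : stdSimplex ℝ (Fin (n + 1))}
    (h : point σ s = point τ t) : Related (X := X) ⟨⟨m, σ⟩, s⟩ ⟨⟨n, τ⟩, t⟩ := by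
  obtain ⟨g, hg⟩ := exists_section_of_point (X := X)
  have := congrArg g h
  rw [hg, hg] at this
  exact Quotient.exact this

/-- The map from the quotient of the cells to the realization has a continuous right inverse, namely
the map of `exists_section_of_point`, and is therefore a quotient map. -/
theorem isQuotientMap_point : IsQuotientMap
    fun a : Cell X => point a.1.2 a.2 := by
  obtain ⟨g, hg⟩ := exists_section_of_point (X := X)
  have hc : Continuous fun a : Cell X =>
      point a.1.2 a.2 := by
    exact continuous_sigma fun s => continuous_point s.2
  have hr : ∀ a b : Cell X, (relatedSetoid X).r a b →
      point a.1.2 a.2 = point b.1.2 b.2 := by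
    rintro a b ⟨m, w, f, g, hw, h1, h2, h3⟩
    rw [← h1, ← h2, ← point_pull, ← point_pull, h3]
  let k : C(Quotient (relatedSetoid X), SSet.toTop.obj X) :=
    ⟨Quotient.lift _ hr, hc.quotient_lift hr⟩
  have hkg : k.comp g = ContinuousMap.id _ := by
    refine hom_ext fun n σ t => ?_
    rw [ContinuousMap.comp_apply, hg]
    rfl
  have hgk : ∀ z, g (k z) = z := by
    intro z
    induction z using Quotient.ind with
    | _ a => exact hg _ _ _
  have hk : IsQuotientMap k := IsQuotientMap.of_inverse g.continuous k.continuous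
    fun z => DFunLike.congr_fun hkg z
  exact hk.comp (isQuotientMap_quot_mk)

theorem point_surjective (x : SSet.toTop.obj X) :
    ∃ (n : ℕ) (σ : Simp X n) (t : stdSimplex ℝ (Fin (n + 1))), point σ t = x := by
  obtain ⟨⟨⟨n, σ⟩, t⟩, h⟩ := isQuotientMap_point.surjective x
  exact ⟨n, σ, t, h⟩

theorem isClosed_iff_point {C : Set (SSet.toTop.obj X)} :
    IsClosed C ↔ ∀ n (σ : Simp X n), IsClosed (point σ ⁻¹' C) := by
  refine ⟨fun h n σ => h.preimage (continuous_point σ), fun h => ?_⟩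
  rw [← isQuotientMap_point.isClosed_preimage, isClosed_sigma_iff]
  exact fun s => h s.1 s.2

end Realization

/-! ### Closed points, subcomplexes and compact subsets of realizations -/

namespace Realization

variable {X Y : SSet.{u}}

instance {a b : ℕ} : Finite (Fin a →o Fin b) := DFunLike.finite _

/-- A monotone map from a simplex to a finite partially ordered set factors through a simplex of
bounded dimension. -/
theorem exists_factorization {P : Type*} [PartialOrder P] [Fintype P] {m : ℕ}
    {h : Fin (m + 1) → P} (hh : Monotone h) :
    ∃ (k : Fin (Fintype.card P)) (d : Fin (k.1 + 1) →o Fin (m + 1))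
      (e : Fin (m + 1) →o Fin (k.1 + 1)), ∀ j, h (d (e j)) = h j := by
  classical
  -- `r` replaces each vertex by a chosen representative of its fibre of `h`. Its image has at most
  -- `card P` elements; `d` enumerates them and `e` records the position of `r j`.
  let r : Fin (m + 1) → Fin (m + 1) := fun j => Function.invFun h (h j)
  have hr : ∀ j, h (r j) = h j := fun j => Function.invFun_eq ⟨j, rfl⟩
  have hrm : Monotone r := by
    intro j j' hj
    rcases (hh hj).eq_or_lt with h1 | h1
    · exact (congrArg (Function.invFun h) h1).le
    · by_contra hc
      have := hh (not_le.1 hc).le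
      rw [hr, hr] at this
      exact absurd h1 (not_lt_of_ge this)
  let T : Finset (Fin (m + 1)) := Finset.univ.image r
  have hTne : 0 < T.card := Finset.card_pos.2 (Finset.univ_nonempty.image r)
  have hTle : T.card ≤ Fintype.card P := by
    have : T = (Finset.univ.image h).image (Function.invFun h) := by
      rw [Finset.image_image]
      rfl
    rw [this]
    exact Finset.card_image_le.trans (Finset.card_le_univ _)
  obtain ⟨k, hk⟩ : ∃ k, T.card = k + 1 := ⟨T.card - 1, by omega⟩
  have he : ∀ j, ∃ i, T.orderEmbOfFin hk i = r j := by
    intro j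
    have : r j ∈ Set.range (T.orderEmbOfFin hk) := by
      rw [Finset.range_orderEmbOfFin]
      exact Finset.mem_image_of_mem r (Finset.mem_univ j)
    exact this
  choose e he using he
  refine ⟨⟨k, by omega⟩, (T.orderEmbOfFin hk).toOrderHom, ⟨e, fun j j' hj => ?_⟩, fun j => ?_⟩
  · rw [← (T.orderEmbOfFin hk).le_iff_le, he, he]
    exact hrm hj
  · change h (T.orderEmbOfFin hk (e j)) = h j
    rw [he, hr]

theorem map_eq_of_factorization {k m p : ℕ} {f : Fin (m + 1) →o Fin (p + 1)}
    {d : Fin (k + 1) →o Fin (m + 1)} {e : Fin (m + 1) →o Fin (k + 1)}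
    (h : ∀ j, f (d (e j)) = f j) (w : stdSimplex ℝ (Fin (m + 1))) :
    stdSimplex.map (f.comp d) (stdSimplex.map e w) = stdSimplex.map f w := by
  rw [← map_comp]
  congr 1
  exact funext h

theorem isClosed_image_map {k p : ℕ} (f : Fin (k + 1) → Fin (p + 1))
    {C : Set (stdSimplex ℝ (Fin (k + 1)))} (hC : IsClosed C) :
    IsClosed (stdSimplex.map f '' C) :=
  have : CompactSpace (stdSimplex ℝ (Fin (k + 1))) :=
    isCompact_iff_compactSpace.1 (isCompact_stdSimplex ℝ _)
  (hC.isCompact.image (stdSimplex.continuous_map f)).isClosed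

/-- Inside a simplex, a given point is seen as a union of compact images over common faces.
Refinements can be replaced by ones of bounded dimension, so the union is finite and hence closed.
-/
instance : T1Space (SSet.toTop.obj X) := by
  refine ⟨fun x => isClosed_iff_point.2 fun p σ => ?_⟩
  obtain ⟨q, τ, s, rfl⟩ := point_surjective x
  have : point σ ⁻¹' {point τ s} =
      ⋃ (k : Fin (Fintype.card (Fin (p + 1) × Fin (q + 1))))
        (f : Fin (k.1 + 1) →o Fin (p + 1)) (g : Fin (k.1 + 1) →o Fin (q + 1))
        (_ : pull f σ = pull g τ), stdSimplex.map f '' (stdSimplex.map g ⁻¹' {s}) := by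
    ext t
    simp only [mem_preimage, mem_singleton_iff, mem_iUnion, mem_image]
    constructor
    · intro h
      obtain ⟨m, w, f, g, hw, h1, h2, h3⟩ := related_of_point_eq h
      obtain ⟨k, d, e, hde⟩ := exists_factorization (f.monotone.prodMk g.monotone)
      refine ⟨k, f.comp d, g.comp d, ?_, stdSimplex.map e w, ?_, ?_⟩
      · rw [← pull_pull, ← pull_pull, h3]
      · rw [map_eq_of_factorization (fun j => congrArg Prod.snd (hde j)), h2]
      · rw [map_eq_of_factorization (fun j => congrArg Prod.fst (hde j)), h1]
    · rintro ⟨k, f, g, h, z, rfl, rfl⟩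
      rw [← point_pull, h, point_pull]
  rw [this]
  refine isClosed_iUnion_of_finite fun k => isClosed_iUnion_of_finite fun f =>
    isClosed_iUnion_of_finite fun g => isClosed_iUnion_of_finite fun _ =>
    isClosed_image_map _ (isClosed_singleton.preimage (stdSimplex.continuous_map g))

theorem mapSimp_pull (φ : X ⟶ Y) {m n : ℕ} (f : Fin (m + 1) →o Fin (n + 1)) (σ : Simp X n) :
    mapSimp φ (pull f σ) = pull f (mapSimp φ σ) :=
  ConcreteCategory.congr_hom (φ.naturality (SimplexCategory.mkHom f).op) σ

/-- A common refinement of the images is an equality of pulled back simplices of `Y`; injectivity on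
simplices lifts it to `X`. -/
theorem toTop_map_injective (φ : X ⟶ Y)
    (hφ : ∀ n, Function.Injective (mapSimp φ : Simp X n → Simp Y n)) :
    Function.Injective (SSet.toTop.map φ) := by
  intro x y h
  obtain ⟨m, σ, s, rfl⟩ := point_surjective x
  obtain ⟨n, τ, t, rfl⟩ := point_surjective y
  rw [toTop_map_point, toTop_map_point] at h
  obtain ⟨l, w, f, g, hw, h1, h2, h3⟩ := related_of_point_eq h
  have h4 : pull f σ = pull g τ := hφ l ((mapSimp_pull φ f σ).trans (h3.trans (mapSimp_pull φ g τ).symm))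
  dsimp only at h1 h2
  rw [← h1, ← h2, ← point_pull, ← point_pull, h4]

/-- The realization of an inclusion is a closed embedding. -/
theorem isClosedEmbedding_toTop_map (φ : X ⟶ Y)
    (hφ : ∀ n, Function.Injective (mapSimp φ : Simp X n → Simp Y n)) :
    IsClosedEmbedding (SSet.toTop.map φ) := by
  have hinj := toTop_map_injective φ hφ
  refine IsClosedEmbedding.of_continuous_injective_isClosedMap
    (SSet.toTop.map φ).hom.continuous hinj fun C hC => isClosed_iff_point.2 fun p σ => ?_
  -- Within `σ`, only pullbacks `pull f σ` that lift to `X` contribute. Bounding their dimension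
  -- makes the union finite.
  have : point σ ⁻¹' (SSet.toTop.map φ '' C) =
      ⋃ (k : Fin (Fintype.card (Fin (p + 1)))) (f : Fin (k.1 + 1) →o Fin (p + 1)),
        stdSimplex.map f ''
          {z | ∃ τ : Simp X k.1, mapSimp φ τ = pull f σ ∧ point τ z ∈ C} := by
    ext t
    simp only [mem_preimage, mem_iUnion, mem_image, mem_ofPred_eq]
    constructor
    · rintro ⟨a, ha, h⟩
      obtain ⟨n, τ, s, rfl⟩ := point_surjective a
      have h' := h
      rw [toTop_map_point] at h'
      obtain ⟨m, w, g, f, hw, h1, h2, h3⟩ := related_of_point_eq h'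
      obtain ⟨k, d, e, hde⟩ := exists_factorization f.monotone
      have h4 : mapSimp φ (pull (g.comp d) τ) = pull (f.comp d) σ := by
        refine (mapSimp_pull φ _ τ).trans ?_
        rw [← pull_pull, ← pull_pull]
        exact congrArg (pull d) h3
      have h5 : stdSimplex.map (f.comp d) (stdSimplex.map e w) = t := by
        rw [map_eq_of_factorization hde, h2]
      refine ⟨k, f.comp d, stdSimplex.map e w, ⟨pull (g.comp d) τ, h4, ?_⟩, h5⟩
      have h6 : point (pull (g.comp d) τ) (stdSimplex.map e w) = point τ s := by
        refine hinj ((toTop_map_point φ _ _).trans (Eq.trans ?_ h.symm))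
        rw [h4, point_pull, h5]
      rw [h6]
      exact ha
    · rintro ⟨k, f, z, ⟨τ, h, hz⟩, rfl⟩
      refine ⟨_, hz, ?_⟩
      exact (toTop_map_point φ τ z).trans (by rw [h, point_pull])
  rw [this]
  refine isClosed_iUnion_of_finite fun k => isClosed_iUnion_of_finite fun f =>
    isClosed_image_map _ ?_
  -- By injectivity the lift is unique, so the set is the trace of `C` on one simplex, or else
  -- empty.
  by_cases h : ∃ τ : Simp X k.1, mapSimp φ τ = pull f σ
  · obtain ⟨τ, hτ⟩ := h
    have : {z | ∃ τ : Simp X k.1, mapSimp φ τ = pull f σ ∧ point τ z ∈ C} = point τ ⁻¹' C := by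
      ext z
      constructor
      · rintro ⟨τ', hτ', hz⟩
        have : τ' = τ := hφ _ (hτ'.trans hτ.symm)
        rwa [this] at hz
      · exact fun hz => ⟨τ, hτ, hz⟩
    rw [this]
    exact hC.preimage (continuous_point τ)
  · convert! isClosed_empty
    ext z
    simp only [mem_ofPred_eq, mem_empty_iff_false, iff_false]
    exact fun ⟨τ, hτ, _⟩ => h ⟨τ, hτ⟩

/-- A compact subset of a geometric realization meets only finitely many stages of an exhaustion
which absorbs every simplex. -/
theorem exists_subset_of_isCompact {K : Set (SSet.toTop.obj X)} (hK : IsCompact K)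
    {S : ℕ → Set (SSet.toTop.obj X)} (hS : Monotone S)
    (h : ∀ n (σ : Simp X n), ∃ N, ∀ t, point σ t ∈ S N) : ∃ N, K ⊆ S N := by
  by_contra! hc
  have : ∀ n, ∃ x ∈ K, x ∉ S n := fun n => Set.not_subset.1 (hc n)
  choose x hxK hxS using this
  -- A simplex lies in some `S N`, which excludes `x k` for `k ≥ N`. It therefore meets only
  -- finitely many of these points, and points are closed.
  have hclosed : ∀ n, IsClosed (x '' Ici n) := by
    refine fun n => isClosed_iff_point.2 fun p σ => ?_
    obtain ⟨N, hN⟩ := h p σ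
    have : point σ ⁻¹' (x '' Ici n) = point σ ⁻¹' (x '' (Ici n ∩ Iio N)) := by
      ext t
      constructor
      · rintro ⟨k, hk, hkt⟩
        refine ⟨k, ⟨hk, ?_⟩, hkt⟩
        by_contra hkN
        exact hxS k (hS (not_lt.1 hkN) (hkt ▸ hN t))
      · rintro ⟨k, hk, hkt⟩
        exact ⟨k, hk.1, hkt⟩
    rw [this]
    exact (((finite_Iio N).inter_of_right _).image x).isClosed.preimage (continuous_point σ)
  have hsub : ∀ n, x '' Ici n ⊆ K := by
    rintro n _ ⟨k, -, rfl⟩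
    exact hxK k
  -- A point common to all tails lies in some `S N`, yet equals some `x k` with `k ≥ N`, which is
  -- impossible.
  obtain ⟨y, hy⟩ := IsCompact.nonempty_iInter_of_sequence_nonempty_isCompact_isClosed
    (fun n => x '' Ici n) (fun n => image_mono (Ici_subset_Ici.2 n.le_succ))
    (fun n => ⟨x n, n, self_mem_Ici, rfl⟩) (hK.of_isClosed_subset (hclosed 0) (hsub 0)) hclosed
  rw [mem_iInter] at hy
  obtain ⟨p, σ, t, rfl⟩ := point_surjective y
  obtain ⟨N, hN⟩ := h p σ
  obtain ⟨k, hk, hkt⟩ := hy N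
  exact hxS k (hS hk (hkt ▸ hN t))

end Realization

open Realization

/-! ### Affine maps act on the underlying simplicial set -/

theorem sum_proj_smulRight_apply {m p : ℕ} (V : Fin m → Fin p → ℝ) (y : Fin m → ℝ) :
    (∑ k, (LinearMap.proj k : (Fin m → ℝ) →ₗ[ℝ] ℝ).smulRight (V k)) y = ∑ k, y k • V k := by
  rw [LinearMap.sum_apply]
  rfl

theorem plInCharts_simplexAffine {m p : ℕ} (V : Fin (m + 1) → stdSimplex ℝ (Fin (p + 1))) :
    PLInCharts (simplexAffine V) (simplexChart m) (simplexChart p) := by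
  have : chartPreimage (simplexAffine V) (simplexChart m) (simplexChart p) =
      stdSimplex ℝ (Fin (m + 1)) := by
    ext y
    exact ⟨fun hy => hy.1, fun hy => ⟨hy, _, rfl⟩⟩
  unfold PLInCharts
  rw [this]
  refine ⟨{stdSimplex ℝ (Fin (m + 1))}, finite_singleton _, sUnion_singleton _, ?_⟩
  rintro P rfl
  refine ⟨isPolytope_stdSimplex _,
    (∑ k, (LinearMap.proj k : (Fin (m + 1) → ℝ) →ₗ[ℝ] ℝ).smulRight (V k).1).toAffineMap, ?_⟩
  intro y hy
  have h : (∑ k, (LinearMap.proj k : (Fin (m + 1) → ℝ) →ₗ[ℝ] ℝ).smulRight (V k).1).toAffineMap y =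
      (simplexAffine V ⟨y, hy⟩).1 := by
    exact sum_proj_smulRight_apply (fun k => (V k).1) y
  exact ⟨hy, h ▸ (simplexAffine V ⟨y, hy⟩).2, Subtype.ext h⟩

theorem continuous_simplexAffine {m p : ℕ} (V : Fin (m + 1) → stdSimplex ℝ (Fin (p + 1))) :
    Continuous (simplexAffine V) := by
  refine Continuous.subtype_mk (continuous_finsetSum _ fun k _ => ?_) _
  exact ((continuous_apply k).comp continuous_subtype_val).smul continuous_const

theorem isPLMap_simplexAffine {m p : ℕ} (V : Fin (m + 1) → stdSimplex ℝ (Fin (p + 1))) :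
    IsPLMap (P := PLSpace.simplex m) (Q := PLSpace.simplex p) (simplexAffine V) := by
  have h : ∀ (n : ℕ) (x : stdSimplex ℝ (Fin (n + 1))), (simplexChart n).image ∈ 𝓝 x := by
    intro n x
    rw [simplexChart_image]
    exact Filter.univ_mem
  exact IsPLMap.of_charts (continuous_simplexAffine V) fun x =>
    ⟨simplexChart m, (simplexChart m).compatible_refl,
      simplexChart p, (simplexChart p).compatible_refl, h m x, h p _, plInCharts_simplexAffine V⟩

/-- An affine map of simplices, as a morphism of PL spaces. -/
noncomputable def affineHom {m p : ℕ} (V : Fin (m + 1) → stdSimplex ℝ (Fin (p + 1))) :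
    PLSpace.simplex m ⟶ PLSpace.simplex p :=
  ⟨simplexAffine V, isPLMap_simplexAffine V⟩

/-- A PL map with values in an open subset is a PL map to that subset. -/
theorem IsPLMap.codRestrict {P Q : PLSpace} {f : P → Q} (hf : IsPLMap f) {U : Set Q}
    (hU : Q.IsPLSubspace U) (h : ∀ x, f x ∈ U) :
    IsPLMap (P := P) (Q := Q.sub U hU) (Set.codRestrict f U h) :=
  IsPLMap.of_charts (hf.1.codRestrict h) fun x => by
    obtain ⟨c, hc, hx⟩ := P.str.cover x
    obtain ⟨d, hd, hx'⟩ := hU.cover ⟨f x, h x⟩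
    exact ⟨c, hc, d, hd, hx, hx', PLInCharts.of_ofSubtype (hf.plInCharts hc hd)⟩

section Affine

variable {F : PLSpaceᵒᵖ ⥤ Type u}

/-- The pullback of a simplex of the underlying simplicial set along an affine map. -/
noncomputable def affinePull {m p : ℕ} (V : Fin (m + 1) → stdSimplex ℝ (Fin (p + 1)))
    (σ : Simp (underlyingSSet.obj F) p) : Simp (underlyingSSet.obj F) m :=
  F.map (affineHom V).op σ

theorem map_op_comp_apply {P Q R : PLSpace} (f : P ⟶ Q) (g : Q ⟶ R) (x : F.obj (op R)) :
    F.map (f ≫ g).op x = F.map f.op (F.map g.op x) := by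
  rw [op_comp, F.map_comp]
  rfl

theorem pull_affinePull {l m p : ℕ} (V : Fin (m + 1) → stdSimplex ℝ (Fin (p + 1)))
    (f : Fin (l + 1) →o Fin (m + 1)) (σ : Simp (underlyingSSet.obj F) p) :
    pull f (affinePull V σ) = affinePull (V ∘ f) σ := by
  have : affineHom (V ∘ f) = simplexFunctor.map (SimplexCategory.mkHom f) ≫ affineHom V :=
    Subtype.ext (funext fun t => (simplexAffine_map V f t).symm)
  exact (map_op_comp_apply _ _ σ).symm.trans
    (congrArg (fun f : PLSpace.simplex _ ⟶ PLSpace.simplex _ => F.map f.op σ) this.symm)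

theorem affinePull_pull {m p p' : ℕ} (V : Fin (m + 1) → stdSimplex ℝ (Fin (p + 1)))
    (κ : Fin (p + 1) →o Fin (p' + 1)) (σ : Simp (underlyingSSet.obj F) p') :
    affinePull V (pull κ σ) = affinePull (stdSimplex.map κ ∘ V) σ := by
  have : affineHom (stdSimplex.map κ ∘ V) =
      affineHom V ≫ simplexFunctor.map (SimplexCategory.mkHom κ) :=
    Subtype.ext (funext fun t => (map_simplexAffine V κ t).symm)
  exact (map_op_comp_apply _ _ σ).symm.trans
    (congrArg (fun f : PLSpace.simplex _ ⟶ PLSpace.simplex _ => F.map f.op σ) this.symm)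

theorem affinePull_vertex {m p : ℕ} (f : Fin (m + 1) →o Fin (p + 1))
    (σ : Simp (underlyingSSet.obj F) p) :
    affinePull (fun j => stdSimplex.vertex (f j)) σ = pull f σ := by
  have : affineHom (fun j => stdSimplex.vertex (f j)) =
      simplexFunctor.map (SimplexCategory.mkHom f) :=
    Subtype.ext (simplexAffine_vertex f)
  rw [affinePull, this]
  rfl

theorem mapSimp_affinePull {F' : PLSpaceᵒᵖ ⥤ Type u} (φ : F' ⟶ F) {m p : ℕ}
    (V : Fin (m + 1) → stdSimplex ℝ (Fin (p + 1))) (σ : Simp (underlyingSSet.obj F') p) :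
    mapSimp (underlyingSSet.map φ) (affinePull V σ) =
      affinePull V (mapSimp (underlyingSSet.map φ) σ) :=
  ConcreteCategory.congr_hom (φ.naturality (affineHom V).op) σ

/-! ### The homotopy from the identity to the edgewise subdivision -/

/-- The homotopy in the join of a simplex and a simplex of its edgewise subdivision. -/
noncomputable def joinPoint {R q p : ℕ} (σ : Simp (underlyingSSet.obj F) p)
    (θ : Fin (blockDim R q + 1) →o Fin (p + 1)) (u : stdSimplex ℝ (Fin (q + 1)))
    (l : unitInterval) : SSet.toTop.obj (underlyingSSet.obj F) :=
  point (affinePull (joinVertex θ) σ) (prodWeight (blockPath R l) u)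

/-- Reindexing inside the blocks is a simplicial operator on the join simplex and leaves the factor
of blocks, where the path moves, untouched. -/
theorem joinPoint_comp_blockMap {R q q' p : ℕ} (σ : Simp (underlyingSSet.obj F) p)
    (θ : Fin (blockDim R q + 1) →o Fin (p + 1)) (g : Fin (q' + 1) →o Fin (q + 1))
    (u : stdSimplex ℝ (Fin (q' + 1))) (l : unitInterval) :
    joinPoint σ (θ.comp (blockMap (RelEmbedding.refl _) g)) u l =
      joinPoint σ θ (stdSimplex.map g u) l := by
  have h1 : affinePull (joinVertex (θ.comp (blockMap (RelEmbedding.refl _) g))) σ =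
      pull (blockMap (RelEmbedding.refl _) g) (affinePull (joinVertex θ) σ) := by
    rw [pull_affinePull, joinVertex_comp_blockMap]
    rfl
  rw [joinPoint, joinPoint, h1, point_pull, map_blockMap_prodWeight]
  congr 2
  exact stdSimplex.map_id_apply _

theorem map_blockMap_barycenter {R q q' : ℕ} (g : Fin (q' + 1) →o Fin (q + 1))
    (u : stdSimplex ℝ (Fin (q' + 1))) :
    stdSimplex.map (blockMap (R := R) (RelEmbedding.refl _) g)
      (prodWeight stdSimplex.barycenter u) =
      prodWeight stdSimplex.barycenter (stdSimplex.map g u) := by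
  rw [map_blockMap_prodWeight]
  congr 1
  exact stdSimplex.map_id_apply _

theorem prodWeight_barycenter_pos {R q : ℕ} {w : stdSimplex ℝ (Fin (q + 1))} (hw : ∀ k, 0 < w k)
    (j : Fin (blockDim R q + 1)) :
    0 < prodWeight (stdSimplex.barycenter (X := Fin (R + 1))) w j := by
  obtain ⟨⟨i, k⟩, rfl⟩ := (blockEquiv R q).surjective j
  rw [prodWeight_blockEquiv]
  refine mul_pos ?_ (hw k)
  have : (stdSimplex.barycenter : stdSimplex ℝ (Fin (R + 1))) i = ((R + 1 : ℕ) : ℝ)⁻¹ :=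
    (stdSimplex.barycenter_apply i).trans (by simp)
  rw [this]
  positivity

/-- Pass to a common interior refinement `w` of `u` and `u'`. The product of the barycenter with `w`
is again interior, so the two refined maps to `Δᵖ`, which agree on it, are equal. Thus the path
depends only on the point of `Δᵖ` where it starts. -/
theorem joinPoint_congr {R q q' p : ℕ} (σ : Simp (underlyingSSet.obj F) p)
    {θ : Fin (blockDim R q + 1) →o Fin (p + 1)} {θ' : Fin (blockDim R q' + 1) →o Fin (p + 1)}
    {u : stdSimplex ℝ (Fin (q + 1))} {u' : stdSimplex ℝ (Fin (q' + 1))}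
    (h : stdSimplex.map θ (prodWeight stdSimplex.barycenter u) =
      stdSimplex.map θ' (prodWeight stdSimplex.barycenter u')) (l : unitInterval) :
    joinPoint σ θ u l = joinPoint σ θ' u' l := by
  obtain ⟨m, w, g, g', hw, rfl, rfl⟩ := exists_common_refinement u u'
  rw [← joinPoint_comp_blockMap, ← joinPoint_comp_blockMap]
  congr 1
  refine orderHom_eq_of_map_eq (prodWeight_barycenter_pos hw) ?_
  rw [map_comp, map_comp, map_blockMap_barycenter, map_blockMap_barycenter, h]

theorem joinPoint_pull {R q p p' : ℕ} (σ : Simp (underlyingSSet.obj F) p')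
    (κ : Fin (p + 1) →o Fin (p' + 1)) (θ : Fin (blockDim R q + 1) →o Fin (p + 1))
    (u : stdSimplex ℝ (Fin (q + 1))) (l : unitInterval) :
    joinPoint (pull κ σ) θ u l = joinPoint σ (κ.comp θ) u l := by
  rw [joinPoint, joinPoint, affinePull_pull, map_comp_joinVertex]
  rfl

/-- At time `0` the path is in the face spanned by the first `R + 1` blocks, where the join simplex
restricts to `pull θ σ`. -/
theorem joinPoint_zero {R q p : ℕ} (σ : Simp (underlyingSSet.obj F) p)
    (θ : Fin (blockDim R q + 1) →o Fin (p + 1)) (u : stdSimplex ℝ (Fin (q + 1))) :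
    joinPoint σ θ u 0 = point σ (stdSimplex.map θ (prodWeight stdSimplex.barycenter u)) := by
  have h1 : prodWeight (blockPath R 0) u = stdSimplex.map
      (blockMap Fin.castSuccOrderEmb OrderHom.id) (prodWeight stdSimplex.barycenter u) := by
    rw [map_blockMap_prodWeight, blockPath_zero]
    congr 1
    exact (stdSimplex.map_id_apply u).symm
  rw [joinPoint, h1, ← point_pull, pull_affinePull, joinVertex_comp_blockMap_castSucc,
    affinePull_vertex, point_pull]

/-- At time `1` all weight is on the last block, where the join simplex restricts to the simplex of
the subdivision. -/
theorem joinPoint_one {R q p : ℕ} (σ : Simp (underlyingSSet.obj F) p)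
    (θ : Fin (blockDim R q + 1) →o Fin (p + 1)) (u : stdSimplex ℝ (Fin (q + 1))) :
    joinPoint σ θ u 1 = point (affinePull (meanVertex θ) σ) u := by
  have h : joinVertex θ ∘ blockIncl (Fin.last (R + 1)) = meanVertex θ :=
    funext fun k => joinVertex_last θ k
  rw [joinPoint, blockPath_one, ← map_blockIncl, ← point_pull, pull_affinePull, h]

theorem continuous_joinPoint {R q p : ℕ} (σ : Simp (underlyingSSet.obj F) p)
    (θ : Fin (blockDim R q + 1) →o Fin (p + 1)) :
    Continuous fun x : stdSimplex ℝ (Fin (q + 1)) × unitInterval => joinPoint σ θ x.1 x.2 :=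
  (continuous_point _).comp (continuous_prodWeight.comp
    (((continuous_blockPath R).comp continuous_snd).prodMk continuous_fst))

/-- Continuity can be checked on a finite cover by images of compact spaces. -/
theorem continuous_of_finite_compact_cover {ι : Type*} [Finite ι] {K : ι → Type*}
    [∀ i, TopologicalSpace (K i)] [∀ i, CompactSpace (K i)] {Z W : Type*} [TopologicalSpace Z]
    [T2Space Z] [TopologicalSpace W] {c : ∀ i, K i → Z} (hc : ∀ i, Continuous (c i))
    (hs : ∀ z, ∃ i x, c i x = z) {f : Z → W} (hf : ∀ i, Continuous fun x => f (c i x)) :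
    Continuous f := by
  have hcont : Continuous fun a : Σ i, K i => c a.1 a.2 := continuous_sigma hc
  have hsurj : Function.Surjective fun a : Σ i, K i => c a.1 a.2 := fun z => by
    obtain ⟨i, x, h⟩ := hs z
    exact ⟨⟨i, x⟩, h⟩
  exact (hcont.isClosedMap.isQuotientMap hcont hsurj).continuous_iff.2 (continuous_sigma hf)

/-- The homotopies in the individual simplices. -/
theorem exists_homotopy_simplex {p : ℕ} (R : ℕ) (σ : Simp (underlyingSSet.obj F) p) :
    ∃ H : C(stdSimplex ℝ (Fin (p + 1)) × unitInterval,
      SSet.toTop.obj (underlyingSSet.obj F)),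
      ∀ (q : ℕ) (θ : Fin (blockDim R q + 1) →o Fin (p + 1)) u l,
        H (stdSimplex.map θ (prodWeight stdSimplex.barycenter u), l) = joinPoint σ θ u l := by
  have : ∀ n, CompactSpace (stdSimplex ℝ (Fin (n + 1))) := fun n =>
    isCompact_iff_compactSpace.1 (isCompact_stdSimplex ℝ _)
  choose q u θ h using exists_edgewise (p := p) R
  obtain ⟨H, hH⟩ : ∃ H : stdSimplex ℝ (Fin (p + 1)) × unitInterval →
      SSet.toTop.obj (underlyingSSet.obj F),
      ∀ (q : ℕ) (θ : Fin (blockDim R q + 1) →o Fin (p + 1)) u l,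
        H (stdSimplex.map θ (prodWeight stdSimplex.barycenter u), l) = joinPoint σ θ u l :=
    -- The choices of `θ` and `u` need not be continuous: the value does not depend on them.
    ⟨fun x => joinPoint σ (θ x.1) (u x.1) x.2, fun q' θ' u' l => joinPoint_congr σ (h _) l⟩
  refine ⟨⟨H, ?_⟩, hH⟩
  -- The bound on `q` in `exists_edgewise` leaves only finitely many pairs `(q, θ)`.
  refine continuous_of_finite_compact_cover
    (ι := Σ q : Fin (Fintype.card (Fin (R + 1) → Fin (p + 1))),
      (Fin (blockDim R q.1 + 1) →o Fin (p + 1)))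
    (K := fun i => stdSimplex ℝ (Fin (i.1.1 + 1)) × unitInterval)
    (c := fun i x => (stdSimplex.map i.2 (prodWeight stdSimplex.barycenter x.1), x.2)) ?_ ?_ ?_
  · intro i
    exact ((stdSimplex.continuous_map _).comp (continuous_prodWeight.comp
      (continuous_const.prodMk continuous_fst))).prodMk continuous_snd
  · exact fun x => ⟨⟨q x.1, θ x.1⟩, (u x.1, x.2), Prod.ext (h x.1) rfl⟩
  · exact fun i => (continuous_joinPoint σ i.2).congr fun x => (hH _ i.2 x.1 x.2).symm

/-- The homotopies are glued in curried form, as maps to the space of paths, so that only the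
universal property of the realization itself is needed and not that of its product with the
interval. -/
theorem exists_homotopy (F : PLSpaceᵒᵖ ⥤ Type u) (R : ℕ) :
    ∃ G : C(SSet.toTop.obj (underlyingSSet.obj F) × unitInterval,
      SSet.toTop.obj (underlyingSSet.obj F)),
      ∀ (p q : ℕ) (σ : Simp (underlyingSSet.obj F) p)
        (θ : Fin (blockDim R q + 1) →o Fin (p + 1)) u l,
        G (point σ (stdSimplex.map θ (prodWeight stdSimplex.barycenter u)), l) =
          joinPoint σ θ u l := by
  choose H hH using fun (p : ℕ) (σ : Simp (underlyingSSet.obj F) p) => exists_homotopy_simplex R σ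
  obtain ⟨G, hG⟩ := exists_desc (X := underlyingSSet.obj F)
    C(unitInterval, SSet.toTop.obj (underlyingSSet.obj F)) (fun p σ => (H p σ).curry) (by
      intro m n κ σ t
      ext l
      obtain ⟨q, u, θ, rfl⟩ := exists_edgewise R t
      rw [ContinuousMap.curry_apply, ContinuousMap.curry_apply, hH, ← map_comp, hH,
        joinPoint_pull])
  refine ⟨G.uncurry, fun p q σ θ u l => ?_⟩
  rw [ContinuousMap.uncurry_apply]
  simp only [Function.uncurry_apply_pair]
  rw [hG, ContinuousMap.curry_apply, hH]

end Affine

/-! ### The homotopy and the subfunctor -/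

section Subfunctor

variable {F : PLSpaceᵒᵖ ⥤ Type u} (F' : Subfunctor F)

theorem mapSimp_ι_injective (n : ℕ) :
    Function.Injective (mapSimp (underlyingSSet.map F'.ι) :
      Simp (underlyingSSet.obj F'.toFunctor) n → Simp (underlyingSSet.obj F) n) :=
  fun _ _ h => Subtype.ext h

theorem joinPoint_mem_range {R q p : ℕ} (τ : Simp (underlyingSSet.obj F'.toFunctor) p)
    (θ : Fin (blockDim R q + 1) →o Fin (p + 1)) (u : stdSimplex ℝ (Fin (q + 1)))
    (l : unitInterval) :
    joinPoint (mapSimp (underlyingSSet.map F'.ι) τ) θ u l ∈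
      range (SSet.toTop.map (underlyingSSet.map F'.ι)) := by
  refine ⟨joinPoint τ θ u l, ?_⟩
  rw [joinPoint, joinPoint, toTop_map_point, mapSimp_affinePull]

variable {F'}

/-- Sufficiently fine edgewise subdivisions of a simplex lie in the subfunctor. -/
theorem LocallyIn.exists_affinePull_mem (hF' : LocallyIn F') {p : ℕ}
    (σ : Simp (underlyingSSet.obj F) p) :
    ∃ N : ℕ, ∀ R ≥ N, ∀ (q : ℕ) (θ : Fin (blockDim R q + 1) →o Fin (p + 1)),
      affinePull (meanVertex θ) σ ∈ F'.obj (op (PLSpace.simplex q)) := by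
  obtain ⟨𝒰, h𝒰, hU⟩ := hF' (PLSpace.simplex p) σ
  have : CompactSpace (stdSimplex ℝ (Fin (p + 1))) :=
    isCompact_iff_compactSpace.1 (isCompact_stdSimplex ℝ _)
  obtain ⟨δ, hδ, hball⟩ := lebesgue_number_lemma_of_metric_sUnion
    (α := stdSimplex ℝ (Fin (p + 1))) (s := univ) (c := 𝒰) isCompact_univ
    (fun U h => (hU U h).choose) h𝒰.ge
  -- The mesh is at most `2 / (R + 1)`, which is below the Lebesgue number `δ` once `R ≥ N`.
  obtain ⟨N, hN⟩ := exists_nat_gt (2 / δ)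
  refine ⟨N, fun R hR q θ => ?_⟩
  obtain ⟨U, hU𝒰, hUball⟩ := hball (meanVertex θ 0) (mem_univ _)
  obtain ⟨hUo, hmem⟩ := hU U hU𝒰
  have hlt : 2 / ((R + 1 : ℕ) : ℝ) < δ := by
    rw [div_lt_iff₀ (by positivity), mul_comm, ← div_lt_iff₀ hδ]
    refine hN.trans ?_
    exact_mod_cast Nat.lt_succ_of_le hR
  have hin : ∀ t, simplexAffine (meanVertex θ) t ∈ U := fun t => hUball
    ((dist_simplexAffine_le _ (fun k a => abs_meanVertex_sub_le θ k 0 a) t).trans_lt hlt)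
  have hUs := (PLSpace.simplex p).isPLSubspace_of_isOpen hUo
  -- The small simplex factors through `U`, so its pullback is a pullback of the restriction of `σ`
  -- to `U`, which lies in `F'`.
  let f : PLSpace.simplex q ⟶ (PLSpace.simplex p).sub U hUs :=
    ⟨_, (isPLMap_simplexAffine (meanVertex θ)).codRestrict hUs hin⟩
  have hf : affineHom (meanVertex θ) = f ≫ (PLSpace.simplex p).subι U hUs := rfl
  have : affinePull (meanVertex θ) σ = F.map f.op (PLSpace.res F hUs σ) := by
    rw [affinePull, hf]
    exact map_op_comp_apply _ _ σ
  rw [this]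
  exact F'.map f.op hmem

end Subfunctor

/-! ### Compression of maps of cubes -/

section Compression

open unitInterval

/-- The distance from the centre of the cube, normalized to be `1` on the boundary. -/
noncomputable def cubeNorm {n : ℕ} (x : Fin n → I) : ℝ := ‖fun i => 2 * (x i : ℝ) - 1‖

theorem continuous_cubeNorm {n : ℕ} : Continuous (cubeNorm (n := n)) := by
  unfold cubeNorm
  fun_prop

theorem abs_le_cubeNorm {n : ℕ} (x : Fin n → I) (i : Fin n) :
    |2 * (x i : ℝ) - 1| ≤ cubeNorm x :=
  norm_le_pi_norm (fun i => 2 * (x i : ℝ) - 1) i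

theorem cubeNorm_le_one {n : ℕ} (x : Fin n → I) : cubeNorm x ≤ 1 := by
  refine (pi_norm_le_iff_of_nonneg zero_le_one).2 fun i => ?_
  rw [Real.norm_eq_abs, abs_le]
  constructor <;> linarith [(x i).2.1, (x i).2.2]

theorem mem_boundary_of_abs_eq_one {n : ℕ} {x : Fin n → I} {i : Fin n}
    (h : |2 * (x i : ℝ) - 1| = 1) : x ∈ Cube.boundary (Fin n) := by
  refine ⟨i, ?_⟩
  rcases eq_or_eq_neg_of_abs_eq h with h | h
  · exact Or.inr (Subtype.ext (by rw [Icc.coe_one]; linarith))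
  · exact Or.inl (Subtype.ext (by rw [Icc.coe_zero]; linarith))

theorem cubeNorm_eq_one {n : ℕ} {x : Fin n → I} (h : x ∈ Cube.boundary (Fin n)) :
    cubeNorm x = 1 := by
  obtain ⟨i, hi⟩ := h
  refine le_antisymm (cubeNorm_le_one x) (le_trans (le_of_eq ?_) (abs_le_cubeNorm x i))
  rcases hi with h | h <;> simp [h]
  norm_num

theorem exists_abs_eq_cubeNorm {n : ℕ} {x : Fin n → I} (h : 0 < cubeNorm x) :
    ∃ i, |2 * (x i : ℝ) - 1| = cubeNorm x := by
  by_contra! hc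
  have : cubeNorm x < cubeNorm x :=
    (pi_norm_lt_iff h).2 fun i => lt_of_le_of_ne (abs_le_cubeNorm x i) (hc i)
  exact lt_irrefl _ this

theorem compression_denom_pos {n : ℕ} (s : I) (x : Fin n → I) :
    0 < max (1 - (s : ℝ) / 2) (cubeNorm x) :=
  lt_max_of_lt_left (by linarith [s.2.2])

/-- A deformation of the cube, in the cylinder over it, to the union of the top and the sides. -/
noncomputable def cubeCompression {n : ℕ} (a : I × (Fin n → I)) : (Fin n → I) × I :=
  (fun i => ⟨(1 + (2 * (a.2 i : ℝ) - 1) / max (1 - (a.1 : ℝ) / 2) (cubeNorm a.2)) / 2, by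
      have h : |(2 * (a.2 i : ℝ) - 1) / max (1 - (a.1 : ℝ) / 2) (cubeNorm a.2)| ≤ 1 := by
        rw [abs_div, abs_of_pos (compression_denom_pos a.1 a.2),
          div_le_one (compression_denom_pos a.1 a.2)]
        exact (abs_le_cubeNorm a.2 i).trans (le_max_right _ _)
      rw [abs_le] at h
      constructor <;> linarith [h.1, h.2]⟩,
    ⟨min (a.1 : ℝ) (2 * (1 - cubeNorm a.2)),
      le_min a.1.2.1 (by linarith [cubeNorm_le_one a.2]), (min_le_left _ _).trans a.1.2.2⟩)

theorem continuous_cubeCompression {n : ℕ} : Continuous (cubeCompression (n := n)) := by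
  have h1 : Continuous fun a : I × (Fin n → I) => cubeNorm a.2 :=
    continuous_cubeNorm.comp continuous_snd
  have h2 : Continuous fun a : I × (Fin n → I) => max (1 - (a.1 : ℝ) / 2) (cubeNorm a.2) :=
    Continuous.max (by fun_prop) h1
  have h3 : ∀ i, Continuous fun a : I × (Fin n → I) =>
      (1 + (2 * (a.2 i : ℝ) - 1) / max (1 - (a.1 : ℝ) / 2) (cubeNorm a.2)) / 2 := by
    intro i
    have h4 : Continuous fun a : I × (Fin n → I) => 2 * (a.2 i : ℝ) - 1 := by fun_prop
    exact (continuous_const.add (h4.div h2 fun a =>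
      (compression_denom_pos a.1 a.2).ne')).div_const 2
  have h5 : Continuous fun a : I × (Fin n → I) => min (a.1 : ℝ) (2 * (1 - cubeNorm a.2)) :=
    Continuous.min (by fun_prop) (continuous_const.mul (continuous_const.sub h1))
  exact continuous_prodMk.2 ⟨continuous_pi fun i => continuous_induced_rng.2 (h3 i),
    continuous_induced_rng.2 h5⟩

theorem cubeCompression_of_max_eq_one {n : ℕ} {s : I} {x : Fin n → I}
    (h : max (1 - (s : ℝ) / 2) (cubeNorm x) = 1) (h' : min (s : ℝ) (2 * (1 - cubeNorm x)) = 0) :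
    cubeCompression (s, x) = (x, 0) := by
  refine Prod.ext (funext fun i => Subtype.ext ?_) (Subtype.ext h')
  change (1 + (2 * (x i : ℝ) - 1) / max (1 - (s : ℝ) / 2) (cubeNorm x)) / 2 = x i
  rw [h]
  ring

theorem cubeCompression_zero {n : ℕ} (x : Fin n → I) : cubeCompression (0, x) = (x, 0) := by
  have := cubeNorm_le_one x
  refine cubeCompression_of_max_eq_one ?_ ?_
  · rw [Icc.coe_zero]
    simpa using this
  · rw [Icc.coe_zero]
    exact min_eq_left (by linarith)

theorem cubeCompression_boundary {n : ℕ} (s : I) {x : Fin n → I}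
    (hx : x ∈ Cube.boundary (Fin n)) : cubeCompression (s, x) = (x, 0) := by
  have h := cubeNorm_eq_one hx
  refine cubeCompression_of_max_eq_one ?_ ?_
  · rw [h]
    exact max_eq_right (by linarith [s.2.1])
  · rw [h, sub_self, mul_zero]
    exact min_eq_right s.2.1

/-- At the final time the concentric cube of half the size is stretched onto the top of the
cylinder. The remaining shell is pushed radially to the sides, with height falling from `1` to `0`.
-/
theorem cubeCompression_one {n : ℕ} (x : Fin n → I) :
    (cubeCompression (1, x)).2 = 1 ∨ (cubeCompression (1, x)).1 ∈ Cube.boundary (Fin n) := by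
  rcases le_or_gt (cubeNorm x) (1 / 2) with h | h
  · left
    refine Subtype.ext ?_
    change min ((1 : I) : ℝ) (2 * (1 - cubeNorm x)) = 1
    rw [Icc.coe_one]
    exact min_eq_left (by linarith)
  · right
    obtain ⟨i, hi⟩ := exists_abs_eq_cubeNorm (by linarith : 0 < cubeNorm x)
    refine mem_boundary_of_abs_eq_one (i := i) ?_
    change |2 * ((1 + (2 * (x i : ℝ) - 1) / max (1 - ((1 : I) : ℝ) / 2) (cubeNorm x)) / 2) - 1| = 1
    have h2 : max (1 - ((1 : I) : ℝ) / 2) (cubeNorm x) = cubeNorm x := by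
      rw [Icc.coe_one]
      exact max_eq_right (by linarith)
    rw [h2, mul_div_cancel₀ _ (two_ne_zero), add_sub_cancel_left, abs_div, hi, abs_of_pos (by linarith),
      div_self (by linarith)]

/-- A map of a cube which can be deformed into a subset, in such a way that the boundary stays in
the subset, can be so deformed relative to the boundary. -/
theorem exists_homotopicRel_of_homotopy {Y : Type*} [TopologicalSpace Y] {B : Set Y} {n : ℕ}
    (f : C(Fin n → I, Y)) (G : C((Fin n → I) × I, Y)) (h0 : ∀ x, G (x, 0) = f x)
    (hB : ∀ x ∈ Cube.boundary (Fin n), ∀ l, G (x, l) ∈ B) (h1 : ∀ x, G (x, 1) ∈ B) :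
    ∃ g : C(Fin n → I, Y), f.HomotopicRel g (Cube.boundary (Fin n)) ∧ ∀ x, g x ∈ B := by
  let H : C(I × (Fin n → I), Y) := G.comp ⟨cubeCompression, continuous_cubeCompression⟩
  refine ⟨H.comp ⟨fun x => (1, x), by fun_prop⟩, ⟨⟨⟨H, fun x => ?_, fun x => rfl⟩, ?_⟩⟩, fun x => ?_⟩
  · change G (cubeCompression (0, x)) = f x
    rw [cubeCompression_zero, h0]
  · intro s x hx
    change G (cubeCompression (s, x)) = f x
    rw [cubeCompression_boundary s hx, h0]
  · change G (cubeCompression (1, x)) ∈ B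
    rcases cubeCompression_one x with h | h
    · rw [← Prod.mk.eta (p := cubeCompression (1, x)), h]
      exact h1 _
    · exact hB _ h _

theorem exists_lift_of_isEmbedding {A Y Z : Type*} [TopologicalSpace A] [TopologicalSpace Y]
    [TopologicalSpace Z] {i : C(A, Y)} (hi : IsEmbedding i) (g : C(Z, Y))
    (hg : ∀ z, g z ∈ range i) : ∃ g' : C(Z, A), ∀ z, i (g' z) = g z := by
  choose g' hg' using hg
  exact ⟨⟨g', hi.continuous_iff.2 (by simpa [Function.comp_def, hg'] using g.continuous)⟩, hg'⟩

/-- An embedding is a weak homotopy equivalence if maps of cubes with boundary in its image can be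
compressed into its image, relative to the boundary. -/
theorem isWeakHomotopyEquiv_of_compression {A Y : Type u} [TopologicalSpace A]
    [TopologicalSpace Y] (i : C(A, Y)) (hi : IsEmbedding i)
    (h : ∀ (n : ℕ) (f : C(Fin n → I, Y)), (∀ x ∈ Cube.boundary (Fin n), f x ∈ range i) →
      ∃ g : C(Fin n → I, Y), f.HomotopicRel g (Cube.boundary (Fin n)) ∧ ∀ x, g x ∈ range i) :
    IsWeakHomotopyEquiv i := by
  have h' : ∀ (n : ℕ) (f : C(Fin n → I, Y)), (∀ x ∈ Cube.boundary (Fin n), f x ∈ range i) →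
      ∃ g : C(Fin n → I, A), f.HomotopicRel (i.comp g) (Cube.boundary (Fin n)) := by
    intro n f hf
    obtain ⟨g, hfg, hg⟩ := h n f hf
    obtain ⟨g', hg'⟩ := exists_lift_of_isEmbedding hi g hg
    have : i.comp g' = g := ContinuousMap.ext hg'
    exact ⟨g', this ▸ hfg⟩
  refine ⟨⟨?_, ?_⟩, fun n x _ => ⟨?_, ?_⟩⟩
  · intro a b hab
    induction a using ZerothHomotopy.rec with | _ a =>
    induction b using ZerothHomotopy.rec with | _ b =>
    obtain ⟨γ⟩ : Joined (i a) (i b) := Quotient.exact hab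
    obtain ⟨g, hg⟩ := h' 1 ⟨fun x => γ (x 0), by fun_prop⟩ (by
      rintro x ⟨j, hj⟩
      rw [Subsingleton.elim j 0] at hj
      rcases hj with hj | hj
      · exact ⟨a, by simp [hj]⟩
      · exact ⟨b, by simp [hj]⟩)
    have h0 : g (fun _ => 0) = a := by
      apply hi.injective
      exact (hg.fst_eq_snd (x := fun _ => 0) ⟨0, Or.inl rfl⟩).symm.trans γ.source
    have h1 : g (fun _ => 1) = b := by
      apply hi.injective
      exact (hg.fst_eq_snd (x := fun _ => 1) ⟨0, Or.inr rfl⟩).symm.trans γ.target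
    exact ZerothHomotopy.sound
      { toFun := fun t => g fun _ => t
        continuous_toFun := by fun_prop
        source' := h0
        target' := h1 }
  · intro y
    induction y using ZerothHomotopy.rec with | _ y =>
    -- A point is a map of the `0`-cube, whose boundary is empty; the compressing homotopy is a path
    -- into the image.
    obtain ⟨g, ⟨H⟩⟩ := h' 0 (ContinuousMap.const _ y) (by rintro x ⟨j, _⟩; exact j.elim0)
    refine ⟨ZerothHomotopy.mk (g fun j => j.elim0), ?_⟩
    exact (ZerothHomotopy.sound (H.toHomotopy.evalAt fun j => j.elim0)).symm
  · intro a b hab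
    induction a using Quotient.ind with | _ a =>
    induction b using Quotient.ind with | _ b =>
    obtain ⟨H⟩ := Quotient.exact hab
    -- A homotopy relative to the boundary is an `(n + 1)`-cube with time as coordinate `0`. Its
    -- ends come from `a` and `b`, and its sides keep the boundary values of `a`, so its whole
    -- boundary lies in the image. Compressing it gives a homotopy in `A`.
    obtain ⟨g, hg⟩ := h' (n + 1) ⟨fun z => H (z 0, Fin.tail z), by
        refine H.continuous.comp ((continuous_apply 0).prodMk (continuous_pi fun j => ?_))
        exact continuous_apply _⟩ (by
      rintro z ⟨j, hj⟩
      induction j using Fin.cases with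
      | zero =>
        rcases hj with hj | hj
        · exact ⟨a.1 (Fin.tail z), by simp [hj]⟩
        · exact ⟨b.1 (Fin.tail z), by simp [hj]⟩
      | succ j => exact ⟨a.1 (Fin.tail z), (H.eq_fst (z 0) ⟨j, hj⟩).symm⟩)
    have hcons : ∀ (t : I) (y : Fin n → I), Fin.cons (α := fun _ => I) t y ∈ Cube.boundary (Fin (n + 1)) →
        i (g (Fin.cons t y)) = H (t, y) := by
      intro t y hy
      have := hg.fst_eq_snd hy
      simpa using this.symm
    refine Quotient.sound ⟨⟨⟨g.comp ⟨fun x => Fin.cons (α := fun _ => I) x.1 x.2, ?_⟩, fun y => ?_, fun y => ?_⟩, ?_⟩⟩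
    · exact Continuous.finCons (A := fun _ => I) continuous_fst continuous_snd
    · apply hi.injective
      exact (hcons 0 y ⟨0, Or.inl rfl⟩).trans (H.apply_zero y)
    · apply hi.injective
      exact (hcons 1 y ⟨0, Or.inr rfl⟩).trans (H.apply_one y)
    · intro t y hy
      apply hi.injective
      refine (hcons t y ?_).trans (H.eq_fst t hy)
      obtain ⟨j, hj⟩ := hy
      exact ⟨j.succ, by simpa using hj⟩
  · intro y
    induction y using Quotient.ind with | _ γ =>
    obtain ⟨g, hg⟩ := h' n γ.1 fun y hy => ⟨x, (γ.2 y hy).symm⟩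
    refine ⟨Quotient.mk _ ⟨g, fun y hy => hi.injective ?_⟩, Quotient.sound hg.symm⟩
    exact (hg.fst_eq_snd hy).symm.trans (γ.2 y hy)

end Compression

/-! ### Proof of the proposition -/

theorem mainTheorem11 (F : PLSpaceᵒᵖ ⥤ Type u) (hF : IsQuasiPL F) (F' : Subfunctor F)
    (hF' : LocallyIn F') :
    SSet.IsWeakHomotopyEquiv (underlyingSSet.map F'.ι) := by
  have hi := isClosedEmbedding_toTop_map (underlyingSSet.map F'.ι) (mapSimp_ι_injective F')
  refine isWeakHomotopyEquiv_of_compression _ hi.isEmbedding fun n f hf => ?_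
  choose G hG using exists_homotopy F
  have hrange : ∀ R, ∀ x ∈ range (SSet.toTop.map (underlyingSSet.map F'.ι)), ∀ l,
      G R (x, l) ∈ range (SSet.toTop.map (underlyingSSet.map F'.ι)) := by
    rintro R _ ⟨a, rfl⟩ l
    obtain ⟨p, τ, t, rfl⟩ := point_surjective a
    obtain ⟨q, u, θ, rfl⟩ := exists_edgewise R t
    rw [toTop_map_point, hG]
    exact joinPoint_mem_range F' τ θ u l
  obtain ⟨N, hN⟩ := exists_subset_of_isCompact (isCompact_range f.continuous)
    -- Quantifying over all `R ≥ N` makes the stages increase with `N`, although the end maps for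
    -- different `R` are unrelated.
    (S := fun N => {x | ∀ R ≥ N, G R (x, 1) ∈
      range (SSet.toTop.map (underlyingSSet.map F'.ι))})
    (fun M N hMN x hx R hR => hx R (hMN.trans hR)) (by
      intro p σ
      obtain ⟨N, hN⟩ := hF'.exists_affinePull_mem σ
      refine ⟨N, fun t R hR => ?_⟩
      obtain ⟨q, u, θ, rfl⟩ := exists_edgewise R t
      rw [hG, joinPoint_one]
      let τ : Simp (underlyingSSet.obj F'.toFunctor) q.1 := ⟨_, hN R hR q.1 θ⟩
      exact ⟨point τ u, toTop_map_point _ τ u⟩)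
  refine exists_homotopicRel_of_homotopy f ((G N).comp (f.prodMap (ContinuousMap.id _)))
    (fun x => ?_) (fun x hx l => hrange N _ (hf x hx) l) fun x => hN ⟨x, rfl⟩ N le_rfl
  obtain ⟨p, σ, t, hσ⟩ := point_surjective (f x)
  obtain ⟨q, u, θ, rfl⟩ := exists_edgewise N t
  change G N (f x, 0) = f x
  rw [← hσ, hG, joinPoint_zero]
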